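/- Let $v_1,v_2\in\mathbb{R}^2$ be linearly independent, let $D\subset\mathbb{R}^2$ be an open set (not necessarily connected) that is invariant under the translations by $v_1$ and $v_2$ and their inverses, and let $\Omega$ be a connected component of $D$ whose boundary is of class $C^2$ (with $\Omega$ lying locally on one side of $\partial\Omega$). Let $\lambda>0$ and $\alpha\in\mathbb{R}$ be constants, and suppose that there is a function $u\in C^2(\overline\Omega)\cap C^3(\Omega)$ with $$\Delta u+\lambda u=0\ \text{ and }\ u>0\ \text{ in }\Omega,\qquad u=0\ \text{ and }\ \langle\nabla u,\nu\rangle=\alpha\ \text{ on }\partial\Omega,$$ where $\nu$ is the unit normal vector to $\partial\Omega$ pointing out of $\Omega$, that is doubly periodic in the sense that $u(x+mv_1+nv_2)=u(x)$ whenever $m,n\in\mathbb{Z}$ and both $x$ and $x+mv_1+nv_2$ lie in $\Omega$. If $$\sup_{\Omega}u<\frac{|\alpha|}{\sqrt{\lambda}},$$ then each connected component $K$ of $\mathbb{R}^2\setminus\Omega$ is strictly convex: for any two distinct points of $K$, the open segment between them lies in the interior of $K$; and, moreover, the curvature of $\partial\Omega$ with respect to $\nu$ is positive at every point of $\partial\Omega$.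 -/

import Mathlib

open Set Filter Topology

/-- The Euclidean plane. -/
abbrev Plane : Type := EuclideanSpace ℝ (Fin 2)

/-- `D` is invariant under all translations of the group generated by `v₁` and `v₂`
(a doubly periodic set, when `v₁` and `v₂` are linearly independent). -/
def IsDoublyPeriodicSet (v₁ v₂ : Plane) (D : Set Plane) : Prop :=
  ∀ x ∈ D, ∀ m n : ℤ, x + (m • v₁ + n • v₂) ∈ D

/-- A function on `Ω` is doubly periodic: it takes the same value at any two points of `Ω`
that differ by an element of the group generated by `v₁` and `v₂`.
(`Ω` may be only one component of a doubly periodic set, so not all translations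
need to preserve it.) -/
def IsDoublyPeriodicOn (v₁ v₂ : Plane) (u : Plane → ℝ) (Ω : Set Plane) : Prop :=
  ∀ x ∈ Ω, ∀ m n : ℤ, x + (m • v₁ + n • v₂) ∈ Ω → u (x + (m • v₁ + n • v₂)) = u x

/-- `φ` is a `C²` defining function of `Ω` near the boundary point `p`: near `p`, the set `Ω` is
`{φ < 0}`, and `φ` vanishes at `p` with nonzero gradient. -/
structure IsC2DefiningFunctionAt (Ω : Set Plane) (p : Plane) (φ : Plane → ℝ) : Prop where
  contDiffAt : ContDiffAt ℝ 2 φ p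
  eq_zero : φ p = 0
  gradient_ne_zero : gradient φ p ≠ 0
  mem_iff : ∀ᶠ x in 𝓝 p, x ∈ Ω ↔ φ x < 0

/-- `Ω` has a boundary of class `C²` (and lies locally on one side of it). -/
def HasC2Boundary (Ω : Set Plane) : Prop :=
  ∀ p ∈ frontier Ω, ∃ φ : Plane → ℝ, IsC2DefiningFunctionAt Ω p φ

/-- `ν` is the unit normal vector of `∂Ω` at `p` that points out of `Ω`. -/
def IsOutwardUnitNormal (Ω : Set Plane) (p ν : Plane) : Prop :=
  ∃ φ : Plane → ℝ, IsC2DefiningFunctionAt Ω p φ ∧ ν = ‖gradient φ p‖⁻¹ • gradient φ p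

/-- `u ∈ C²(closure Ω) ∩ C³(Ω)` is a positive solution of `Δu + lam u = 0` in `Ω` with
`u = 0` and `⟨∇u, ν⟩ = α` on `∂Ω`, where `ν` is the outward unit normal. At a boundary point,
`⟨∇u, ν⟩` is the value at `ν` of the derivative of `u` relative to the closure of `Ω`. -/
structure IsOverdeterminedSolution (Ω : Set Plane) (lam α : ℝ) (u : Plane → ℝ) : Prop where
  contDiffOn_closure : ContDiffOn ℝ 2 u (closure Ω)
  contDiffOn : ContDiffOn ℝ 3 u Ω
  equation : ∀ x ∈ Ω, Laplacian.laplacian u x + lam * u x = 0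
  pos : ∀ x ∈ Ω, 0 < u x
  dirichlet : ∀ p ∈ frontier Ω, u p = 0
  neumann : ∀ p ∈ frontier Ω, ∀ ν : Plane, IsOutwardUnitNormal Ω p ν →
    fderivWithin ℝ u (closure Ω) p ν = α

/-- The curvature at parameter `0` of a regular curve `γ` with respect to the unit normal `ν`:
`⟨γ'', ν⟩ / |γ'|²`, which is `⟨γ'', ν⟩` when `γ` is parametrized by arclength. -/
noncomputable def curvatureAtZero (γ : ℝ → Plane) (ν : Plane) : ℝ :=
  inner ℝ (deriv (deriv γ) 0) ν / ‖deriv γ 0‖ ^ 2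

/-- The curvature of `∂Ω` with respect to the outward unit normal of `Ω` is everywhere positive,
computed along any `C²` regular arc in `∂Ω`. -/
def HasPositiveBoundaryCurvature (Ω : Set Plane) : Prop :=
  ∀ (γ : ℝ → Plane) (ν : Plane), ContDiffAt ℝ 2 γ 0 → deriv γ 0 ≠ 0 →
    (∀ᶠ s in 𝓝 (0 : ℝ), γ s ∈ frontier Ω) → IsOutwardUnitNormal Ω (γ 0) ν →
    0 < curvatureAtZero γ ν

/-! The curvature sign comes from a maximum principle for `|∇u|² + lam u² + δ u` with a small `δ >
0`. Its boundary value is `α²`. The strict bound on `u` leaves room for `lam M² + δ M < α²`, so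
wherever the function exceeds `α²` the gradient is bounded away from zero; there the Hessian
estimate of `pFunction_inequality` excludes an interior maximum. As `Ω` may be unbounded, maxima are
produced by subtracting `ε |x - x₀|²`, and this works because `|∇u|` is bounded
(`exists_gradient_bound`, Bernstein's method). The result is `pFunction_le`.

At a boundary point the inward derivative of this function is therefore nonpositive. The term `δ u`
makes the conclusion strict, in place of a Hopf lemma: `D²u(ν, ν) < 0`. The equation gives `D²u`
trace zero on the boundary, so `D²u(w, w) > 0` for tangential `w ≠ 0`; differentiating `u = 0` twice
along the boundary turns this into positive curvature, as `α < 0`.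

Positive curvature makes the complement strictly convex near each boundary point
(`exists_ball_openSegment_subset`). A component of the complement is closed, connected and locally
convex, hence convex by Tietze–Nakajima, and strictness is again a local matter. -/

/-! ### Second-order calculus on a line -/

/-- `g` has first derivative `a` and second derivative `b` at `0`. -/
def HasTwoJet (g : ℝ → ℝ) (a b : ℝ) : Prop :=
  ∃ g' : ℝ → ℝ, (∀ᶠ t in 𝓝 (0 : ℝ), HasDerivAt g (g' t) t) ∧ g' 0 = a ∧ HasDerivAt g' b 0

namespace HasTwoJet

theorem congr_coeff {g : ℝ → ℝ} {a b a' b' : ℝ} (h : HasTwoJet g a b) (ha : a = a')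
    (hb : b = b') : HasTwoJet g a' b' := ha ▸ hb ▸ h

theorem add {g₁ g₂ : ℝ → ℝ} {a₁ b₁ a₂ b₂ : ℝ} (h₁ : HasTwoJet g₁ a₁ b₁)
    (h₂ : HasTwoJet g₂ a₂ b₂) : HasTwoJet (fun t => g₁ t + g₂ t) (a₁ + a₂) (b₁ + b₂) := by
  obtain ⟨g₁', h₁, rfl, k₁⟩ := h₁
  obtain ⟨g₂', h₂, rfl, k₂⟩ := h₂
  refine ⟨fun t => g₁' t + g₂' t, ?_, rfl, k₁.add k₂⟩
  filter_upwards [h₁, h₂] with t ht₁ ht₂ using ht₁.add ht₂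

theorem mul {g₁ g₂ : ℝ → ℝ} {a₁ b₁ a₂ b₂ : ℝ} (h₁ : HasTwoJet g₁ a₁ b₁)
    (h₂ : HasTwoJet g₂ a₂ b₂) :
    HasTwoJet (fun t => g₁ t * g₂ t) (a₁ * g₂ 0 + g₁ 0 * a₂)
      (b₁ * g₂ 0 + 2 * (a₁ * a₂) + g₁ 0 * b₂) := by
  obtain ⟨g₁', h₁, rfl, k₁⟩ := h₁
  obtain ⟨g₂', h₂, rfl, k₂⟩ := h₂
  refine ⟨fun t => g₁' t * g₂ t + g₁ t * g₂' t, ?_, rfl, ?_⟩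
  · filter_upwards [h₁, h₂] with t ht₁ ht₂ using ht₁.mul ht₂
  · exact ((k₁.mul h₂.self_of_nhds).add (h₁.self_of_nhds.mul k₂)).congr_deriv (by ring)

theorem const (c : ℝ) : HasTwoJet (fun _ => c) 0 0 :=
  ⟨fun _ => 0, Eventually.of_forall fun t => hasDerivAt_const t c, rfl, hasDerivAt_const 0 0⟩

theorem quadratic (a b c : ℝ) : HasTwoJet (fun t => a + b * t + c * t ^ 2) b (2 * c) := by
  refine ⟨fun t => b + 2 * c * t, Eventually.of_forall fun t => ?_, by simp, ?_⟩
  · exact ((((hasDerivAt_id t).const_mul b).const_add a).add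
      (((hasDerivAt_id t).pow 2).const_mul c)).congr_deriv (by simp; ring)
  · exact (((hasDerivAt_id (0 : ℝ)).const_mul (2 * c)).const_add b).congr_deriv (by simp)

/-- If `b > 0`, the second derivative test makes `0` a local minimum as well, so `g` is locally
constant and `b = 0`. -/
theorem eq_zero_and_nonpos_of_isLocalMax {g : ℝ → ℝ} {a b : ℝ} (h : HasTwoJet g a b)
    (hmax : IsLocalMax g 0) : a = 0 ∧ b ≤ 0 := by
  obtain ⟨g', h, rfl, k⟩ := h
  have h0 : g' 0 = 0 := hmax.hasDerivAt_eq_zero h.self_of_nhds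
  refine ⟨h0, ?_⟩
  by_contra! hb
  have hd : deriv g =ᶠ[𝓝 0] g' := h.mono fun t ht => ht.deriv
  have hdd : deriv (deriv g) 0 = b := by rw [hd.deriv_eq, k.deriv]
  have hmin : IsLocalMin g 0 := isLocalMin_of_deriv_deriv_pos (by rw [hdd]; exact hb)
    (by rw [hd.eq_of_nhds, h0]) h.self_of_nhds.continuousAt
  have hc : g =ᶠ[𝓝 0] fun _ => g 0 := by
    filter_upwards [hmin, hmax] with t h₁ h₂ using le_antisymm h₂ h₁
  have : deriv (deriv g) 0 = 0 := by
    rw [hc.deriv.deriv_eq]; simp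
  linarith

end HasTwoJet

/-! ### Partial derivatives of interior solutions -/

/-- The standard basis of the plane. -/
noncomputable def planeBasis (i : Fin 2) : Plane := EuclideanSpace.single i 1

/-- Partial derivatives of a function on the plane. -/
noncomputable def partialDeriv (i : Fin 2) (f : Plane → ℝ) (x : Plane) : ℝ :=
  fderiv ℝ f x (planeBasis i)

theorem hasDerivAt_along_planeBasis {f : Plane → ℝ} {x : Plane} {i : Fin 2} {t : ℝ}
    (h : DifferentiableAt ℝ f (x + t • planeBasis i)) :
    HasDerivAt (fun t : ℝ => f (x + t • planeBasis i))
      (partialDeriv i f (x + t • planeBasis i)) t := by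
  have h1 : HasDerivAt (fun t : ℝ => x + t • planeBasis i) (planeBasis i) t := by
    simpa using ((hasDerivAt_id t).smul_const (planeBasis i)).const_add x
  exact h.hasFDerivAt.comp_hasDerivAt t h1

theorem ContDiffAt.contDiffAt_partialDeriv {f : Plane → ℝ} {x : Plane} {m n : WithTop ℕ∞}
    (h : ContDiffAt ℝ n f x) (hmn : m + 1 ≤ n) (i : Fin 2) :
    ContDiffAt ℝ m (partialDeriv i f) x :=
  (h.fderiv_right hmn).clm_apply contDiffAt_const

theorem partialDeriv_partialDeriv_eq {f : Plane → ℝ} {x : Plane} (h : ContDiffAt ℝ 2 f x)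
    (i j : Fin 2) : partialDeriv i (partialDeriv j f) x =
      fderiv ℝ (fderiv ℝ f) x (planeBasis i) (planeBasis j) := by
  have hd : DifferentiableAt ℝ (fderiv ℝ f) x :=
    (h.fderiv_right (m := 1) (by norm_num)).differentiableAt (by norm_num)
  unfold partialDeriv
  rw [fderiv_clm_apply hd (differentiableAt_const _)]
  simp

theorem partialDeriv_comm {f : Plane → ℝ} {x : Plane} (h : ContDiffAt ℝ 2 f x)
    (i j : Fin 2) : partialDeriv i (partialDeriv j f) x = partialDeriv j (partialDeriv i f) x := by
  rw [partialDeriv_partialDeriv_eq h, partialDeriv_partialDeriv_eq h]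
  exact h.isSymmSndFDerivAt (by simp) _ _

theorem laplacian_eq_partialDeriv {f : Plane → ℝ} {x : Plane} (h : ContDiffAt ℝ 2 f x) :
    Laplacian.laplacian f x =
      partialDeriv 0 (partialDeriv 0 f) x + partialDeriv 1 (partialDeriv 1 f) x := by
  rw [InnerProductSpace.laplacian_eq_iteratedFDeriv_orthonormalBasis f
    (EuclideanSpace.basisFun (Fin 2) ℝ), partialDeriv_partialDeriv_eq h,
    partialDeriv_partialDeriv_eq h]
  simp [iteratedFDeriv_two_apply, Fin.sum_univ_two, planeBasis]

theorem partialDeriv_congr {f g : Plane → ℝ} {x : Plane} (h : f =ᶠ[𝓝 x] g) (i : Fin 2) :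
    partialDeriv i f x = partialDeriv i g x := by
  unfold partialDeriv; rw [h.fderiv_eq]

theorem ContDiffAt.hasTwoJet {f : Plane → ℝ} {x : Plane} (h : ContDiffAt ℝ 2 f x) (i : Fin 2) :
    HasTwoJet (fun t : ℝ => f (x + t • planeBasis i)) (partialDeriv i f x)
      (partialDeriv i (partialDeriv i f) x) := by
  have hc : Tendsto (fun t : ℝ => x + t • planeBasis i) (𝓝 0) (𝓝 x) := by
    have : Continuous (fun t : ℝ => x + t • planeBasis i) := by fun_prop
    simpa using this.tendsto 0
  refine ⟨fun t => partialDeriv i f (x + t • planeBasis i), ?_, by simp, ?_⟩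
  · have h1 : ∀ᶠ y in 𝓝 x, DifferentiableAt ℝ f y :=
      (h.eventually (by simp)).mono fun y hy => hy.differentiableAt (by norm_num)
    exact (hc.eventually h1).mono fun t ht => hasDerivAt_along_planeBasis ht
  · have h2 := hasDerivAt_along_planeBasis (f := partialDeriv i f) (x := x) (i := i) (t := 0)
      (by simpa using (h.contDiffAt_partialDeriv (m := 1) (by norm_num) i).differentiableAt (by norm_num))
    simpa using h2

theorem IsLocalMax.comp_planeBasis {f : Plane → ℝ} {x : Plane} (h : IsLocalMax f x) (i : Fin 2) :
    IsLocalMax (fun t : ℝ => f (x + t • planeBasis i)) 0 := by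
  have hc : Tendsto (fun t : ℝ => x + t • planeBasis i) (𝓝 0) (𝓝 x) := by
    have : Continuous (fun t : ℝ => x + t • planeBasis i) := by fun_prop
    simpa using this.tendsto 0
  have := hc.eventually h
  simpa [IsLocalMax, IsMaxFilter] using this

/-- The derivatives up to order three of a solution of `Δu + lam u = 0` at an interior point. -/
theorem exists_twoJets_of_helmholtz {Ω : Set Plane} (hΩ : IsOpen Ω) {lam : ℝ} {u : Plane → ℝ}
    (hu : ContDiffOn ℝ 3 u Ω) (heq : ∀ x ∈ Ω, Laplacian.laplacian u x + lam * u x = 0)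
    {x : Plane} (hx : x ∈ Ω) :
    ∃ a b c T00 T01 T10 T11 : ℝ,
      HasTwoJet (fun t : ℝ => u (x + t • planeBasis 0)) (partialDeriv 0 u x) a ∧
      HasTwoJet (fun t : ℝ => u (x + t • planeBasis 1)) (partialDeriv 1 u x) c ∧
      HasTwoJet (fun t : ℝ => partialDeriv 0 u (x + t • planeBasis 0)) a T00 ∧
      HasTwoJet (fun t : ℝ => partialDeriv 0 u (x + t • planeBasis 1)) b T10 ∧
      HasTwoJet (fun t : ℝ => partialDeriv 1 u (x + t • planeBasis 0)) b T01 ∧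
      HasTwoJet (fun t : ℝ => partialDeriv 1 u (x + t • planeBasis 1)) c T11 ∧
      a + c = -lam * u x ∧ T00 + T10 = -lam * partialDeriv 0 u x ∧
      T01 + T11 = -lam * partialDeriv 1 u x := by
  have h3 : ∀ y ∈ Ω, ContDiffAt ℝ 3 u y := fun y hy => hu.contDiffAt (hΩ.mem_nhds hy)
  have h2 : ∀ y ∈ Ω, ContDiffAt ℝ 2 u y := fun y hy => (h3 y hy).of_le (by norm_num)
  have hp : ∀ (i : Fin 2), ∀ y ∈ Ω, ContDiffAt ℝ 2 (partialDeriv i u) y :=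
    fun i y hy => (h3 y hy).contDiffAt_partialDeriv (by norm_num) i
  have hlap : ∀ y ∈ Ω, partialDeriv 0 (partialDeriv 0 u) y + partialDeriv 1 (partialDeriv 1 u) y
      = -lam * u y := fun y hy => by
    have := heq y hy
    rw [laplacian_eq_partialDeriv (h2 y hy)] at this
    linarith
  -- Moving `∂ⱼ` to the outside, which uses `C³`, lets the differentiated equation compute `Δ ∂ⱼu`.
  have hthird : ∀ i j : Fin 2, partialDeriv i (partialDeriv i (partialDeriv j u)) x =
      partialDeriv j (partialDeriv i (partialDeriv i u)) x := fun i j => by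
    have : partialDeriv i (partialDeriv j u) =ᶠ[𝓝 x] partialDeriv j (partialDeriv i u) := by
      filter_upwards [hΩ.mem_nhds hx] with y hy using partialDeriv_comm (h2 y hy) i j
    rw [partialDeriv_congr this, partialDeriv_comm (hp i x hx)]
  have hsum : ∀ j : Fin 2, partialDeriv 0 (partialDeriv 0 (partialDeriv j u)) x +
      partialDeriv 1 (partialDeriv 1 (partialDeriv j u)) x = -lam * partialDeriv j u x := fun j => by
    rw [hthird, hthird]
    have hd : ∀ i : Fin 2, DifferentiableAt ℝ (partialDeriv i (partialDeriv i u)) x := fun i =>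
      ((hp i x hx).contDiffAt_partialDeriv (m := 1) (by norm_num) i).differentiableAt (by norm_num)
    have e1 : (fun y => partialDeriv 0 (partialDeriv 0 u) y + partialDeriv 1 (partialDeriv 1 u) y)
        =ᶠ[𝓝 x] fun y => -lam * u y := by
      filter_upwards [hΩ.mem_nhds hx] with y hy using hlap y hy
    have e2 := partialDeriv_congr e1 j
    rw [partialDeriv, partialDeriv, fderiv_fun_add (hd 0) (hd 1),
      fderiv_const_mul ((h2 x hx).differentiableAt (by norm_num))] at e2
    simpa [partialDeriv] using e2
  refine ⟨_, partialDeriv 0 (partialDeriv 1 u) x, _, _, _, _, _, (h2 x hx).hasTwoJet 0,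
    (h2 x hx).hasTwoJet 1, (hp 0 x hx).hasTwoJet 0, ?_, (hp 1 x hx).hasTwoJet 0,
    (hp 1 x hx).hasTwoJet 1, hlap x hx, hsum 0, hsum 1⟩
  rw [partialDeriv_comm (h2 x hx) 0 1]
  exact (hp 0 x hx).hasTwoJet 1

/-! ### Bernstein's gradient bound -/

theorem norm_sq_add_smul_planeBasis_sub (x x₀ : Plane) (t : ℝ) (i : Fin 2) :
    ‖x + t • planeBasis i - x₀‖ ^ 2 = ‖x - x₀‖ ^ 2 + (2 * (x - x₀) i) * t + 1 * t ^ 2 := by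
  have : x + t • planeBasis i - x₀ = (x - x₀) + t • planeBasis i := by abel
  rw [this, norm_add_sq_real, norm_smul, inner_smul_right]
  simp [planeBasis, EuclideanSpace.inner_single_right]
  ring

theorem hasTwoJet_norm_sq (x x₀ : Plane) (i : Fin 2) :
    HasTwoJet (fun t : ℝ => ‖x + t • planeBasis i - x₀‖ ^ 2) (2 * (x - x₀) i) 2 := by
  simp_rw [norm_sq_add_smul_planeBasis_sub]
  exact (HasTwoJet.quadratic _ _ _).congr_coeff rfl (by norm_num)

theorem plane_norm_sq (x : Plane) : ‖x‖ ^ 2 = x 0 ^ 2 + x 1 ^ 2 := by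
  simp [EuclideanSpace.norm_sq_eq, Fin.sum_univ_two]

/-- A function that is continuous on the closure of `Ω` attains its maximum over the part of the
closure in a closed ball; the maximum point is an interior local maximum unless it lies on the
boundary of `Ω` or of the ball. -/
theorem exists_max_closure_inter_closedBall {Ω : Set Plane} (hΩ : IsOpen Ω) {F : Plane → ℝ}
    (hF : ContinuousOn F (closure Ω)) {x₀ : Plane} (hx₀ : x₀ ∈ Ω) {R : ℝ} (hR : 0 < R) :
    ∃ x ∈ closure Ω, F x₀ ≤ F x ∧ ‖x - x₀‖ ≤ R ∧
      (x ∈ frontier Ω ∨ ‖x - x₀‖ = R ∨ (x ∈ Ω ∧ IsLocalMax F x)) := by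
  have hK : IsCompact (closure Ω ∩ Metric.closedBall x₀ R) :=
    (isCompact_closedBall x₀ R).inter_left isClosed_closure
  obtain ⟨x, ⟨hxc, hxb⟩, hmax⟩ := hK.exists_isMaxOn
    ⟨x₀, subset_closure hx₀, Metric.mem_closedBall_self hR.le⟩ (hF.mono inter_subset_left)
  have hxR : ‖x - x₀‖ ≤ R := by simpa [dist_eq_norm] using hxb
  refine ⟨x, hxc, hmax ⟨subset_closure hx₀, Metric.mem_closedBall_self hR.le⟩, hxR, ?_⟩
  by_cases hxf : x ∈ frontier Ω
  · exact Or.inl hxf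
  have hxΩ : x ∈ Ω := by
    by_contra h
    exact hxf ⟨hxc, by rwa [hΩ.interior_eq]⟩
  rcases hxR.eq_or_lt with h | h
  · exact Or.inr (Or.inl h)
  refine Or.inr (Or.inr ⟨hxΩ, hmax.isLocalMax ?_⟩)
  refine inter_mem (mem_of_superset (hΩ.mem_nhds hxΩ) subset_closure) ?_
  exact Metric.closedBall_mem_nhds_of_mem (by simpa [dist_eq_norm] using h)

/-- The last hypothesis is `ΔF ≤ 0` for `F = z² |∇u|² + (lam + 21) u²`, with cutoff `z = 1 - |y|²`.
The cross term is absorbed by the squares of `z D²u - 4 y ⊗ ∇u`. In half of `ΔF` the losses are at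
most `16 + 4 + lam` times `|∇u|²`, so the coefficient `lam + 21` leaves one copy of `|∇u|²`. -/
theorem bernstein_inequality {a b c T00 T01 T10 T11 p q u lam z y₀ y₁ : ℝ} (hlam : 0 < lam)
    (hz : z = 1 - (y₀ ^ 2 + y₁ ^ 2)) (hz0 : 0 ≤ z)
    (hT0 : T00 + T10 = -lam * p) (hT1 : T01 + T11 = -lam * q) (htr : a + c = -lam * u)
    (h : (8 * y₀ ^ 2 - 4 * z) * (p ^ 2 + q ^ 2) + 2 * (-4 * z * y₀) * (2 * (p * a + q * b)) +
        z ^ 2 * (2 * (a ^ 2 + p * T00 + b ^ 2 + q * T01)) + (lam + 21) * (2 * (p ^ 2 + u * a)) +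
      ((8 * y₁ ^ 2 - 4 * z) * (p ^ 2 + q ^ 2) + 2 * (-4 * z * y₁) * (2 * (p * b + q * c)) +
        z ^ 2 * (2 * (b ^ 2 + p * T10 + c ^ 2 + q * T11)) + (lam + 21) * (2 * (q ^ 2 + u * c)))
      ≤ 0) :
    p ^ 2 + q ^ 2 ≤ (lam + 21) * lam * u ^ 2 := by
  have hy : y₀ ^ 2 + y₁ ^ 2 ≤ 1 := by linarith
  have hz1 : z ≤ 1 := by nlinarith [sq_nonneg y₀, sq_nonneg y₁]
  obtain rfl : T10 = -lam * p - T00 := by linarith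
  obtain rfl : T11 = -lam * q - T01 := by linarith
  obtain rfl : c = -lam * u - a := by linarith
  set N := p ^ 2 + q ^ 2 with hN
  have hN0 : 0 ≤ N := by positivity
  set c := -lam * u - a with hc
  have hsq : 0 ≤ (z * a - 4 * y₀ * p) ^ 2 + (z * b - 4 * y₀ * q) ^ 2 + (z * b - 4 * y₁ * p) ^ 2 +
      (z * c - 4 * y₁ * q) ^ 2 := by positivity
  have h1 : 16 * (y₀ ^ 2 + y₁ ^ 2) * N ≤ 16 * N := by nlinarith
  have h2 : z ^ 2 * N ≤ N := by nlinarith [mul_nonneg hz0 hN0]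
  have h3 : lam * (z ^ 2 * N) ≤ lam * N := by gcongr
  have h4 : 0 ≤ 8 * (y₀ ^ 2 + y₁ ^ 2) * N := by positivity
  have h5 : z * N ≤ N := by nlinarith
  nlinarith

/-- Interior and boundary data used by the maximum principles: a solution of `Δu + lam u = 0` in
`Ω` with values in `[0, M]`, whose partial derivatives extend continuously as `p`, `q` to the
closure, with zero boundary values and gradient of constant length `|α|` on the boundary. -/
structure IsHelmholtzWithConstantGradient (Ω : Set Plane) (lam α M : ℝ) (u p q : Plane → ℝ) :
    Prop where
  isOpen : IsOpen Ω
  contDiffOn : ContDiffOn ℝ 3 u Ω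
  equation : ∀ x ∈ Ω, Laplacian.laplacian u x + lam * u x = 0
  nonneg : ∀ x ∈ closure Ω, 0 ≤ u x
  le : ∀ x ∈ closure Ω, u x ≤ M
  continuousOn : ContinuousOn u (closure Ω)
  continuousOn_fst : ContinuousOn p (closure Ω)
  continuousOn_snd : ContinuousOn q (closure Ω)
  fst_eq : ∀ x ∈ Ω, p x = partialDeriv 0 u x
  snd_eq : ∀ x ∈ Ω, q x = partialDeriv 1 u x
  dirichlet : ∀ x ∈ frontier Ω, u x = 0
  gradient : ∀ x ∈ frontier Ω, p x ^ 2 + q x ^ 2 = α ^ 2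

/-- Bernstein's gradient bound. It is uniform on the possibly unbounded set `Ω`, which makes the
maximum principle below available without any use of periodicity. -/
theorem IsHelmholtzWithConstantGradient.exists_gradient_bound {Ω : Set Plane} {lam α M : ℝ}
    {u p q : Plane → ℝ} (h : IsHelmholtzWithConstantGradient Ω lam α M u p q) (hlam : 0 < lam) :
    ∃ B : ℝ, ∀ x ∈ closure Ω, p x ^ 2 + q x ^ 2 ≤ B := by
  -- The summands bound `|∇u|²` at a maximum on `∂Ω`, `|∇u|²` at an interior maximum, and the `u²`
  -- term of `F`.
  set B := α ^ 2 + (lam + 21) * lam * M ^ 2 + (lam + 21) * M ^ 2 with hB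
  refine ⟨B, ?_⟩
  have hΩB : ∀ x ∈ Ω, p x ^ 2 + q x ^ 2 ≤ B := ?_
  · have hN : ContinuousOn (fun x => p x ^ 2 + q x ^ 2) (closure Ω) :=
      (h.continuousOn_fst.pow 2).add (h.continuousOn_snd.pow 2)
    exact fun x hx => ContinuousWithinAt.closure_le hx ((hN x hx).mono subset_closure)
      continuousWithinAt_const hΩB
  intro x₀ hx₀
  set F : Plane → ℝ := fun x => (1 + -1 * ‖x - x₀‖ ^ 2) * (1 + -1 * ‖x - x₀‖ ^ 2) *
    (p x * p x + q x * q x) + (lam + 21) * (u x * u x) with hF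
  have hFc : ContinuousOn F (closure Ω) := by
    have h1 := h.continuousOn; have h2 := h.continuousOn_fst; have h3 := h.continuousOn_snd
    fun_prop
  obtain ⟨x, hxc, hFx, hxR, hcase⟩ :=
    exists_max_closure_inter_closedBall h.isOpen hFc hx₀ one_pos
  have hu0 := h.nonneg x hxc
  have huM := h.le x hxc
  have huM2 : u x ^ 2 ≤ M ^ 2 := by gcongr
  have hx2 : ‖x - x₀‖ ^ 2 ≤ 1 := by nlinarith [norm_nonneg (x - x₀)]
  have hF0 : p x₀ ^ 2 + q x₀ ^ 2 ≤ F x₀ := by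
    simp only [hF, sub_self, norm_zero]
    nlinarith [mul_nonneg (by linarith : 0 ≤ lam + 21) (mul_self_nonneg (u x₀))]
  refine hF0.trans (hFx.trans ?_)
  have hM2 : (lam + 21) * u x ^ 2 ≤ (lam + 21) * M ^ 2 := by gcongr
  have hlM : 0 ≤ (lam + 21) * lam * M ^ 2 := by positivity
  have hz : (1 + -1 * ‖x - x₀‖ ^ 2) * (1 + -1 * ‖x - x₀‖ ^ 2) ≤ 1 := by
    nlinarith [sq_nonneg ‖x - x₀‖]
  have hFle : F x ≤ p x ^ 2 + q x ^ 2 + (lam + 21) * u x ^ 2 := by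
    simp only [hF]
    nlinarith [mul_le_mul_of_nonneg_right hz (by positivity : 0 ≤ p x ^ 2 + q x ^ 2)]
  rcases hcase with hxf | hxR | ⟨hxΩ, hmax⟩
  · rw [h.gradient x hxf] at hFle
    linarith
  · simp only [hF, hxR]
    nlinarith [sq_nonneg α]
  · obtain ⟨a, b, c, T00, T01, T10, T11, ju0, ju1, jp0, jp1, jq0, jq1, htr, hT0, hT1⟩ :=
      exists_twoJets_of_helmholtz h.isOpen h.contDiffOn h.equation hxΩ
    -- Near the interior point `x`, `G` is `F` with `p`, `q` replaced by genuine partial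
    -- derivatives, whose jets are known.
    set G : Plane → ℝ := fun x => (1 + -1 * ‖x - x₀‖ ^ 2) * (1 + -1 * ‖x - x₀‖ ^ 2) *
      (partialDeriv 0 u x * partialDeriv 0 u x + partialDeriv 1 u x * partialDeriv 1 u x) +
      (lam + 21) * (u x * u x) with hG
    have hGmax : IsLocalMax G x := hmax.congr (by
      filter_upwards [h.isOpen.mem_nhds hxΩ] with y hy
      simp only [hF, hG, h.fst_eq y hy, h.snd_eq y hy])
    have jz := fun i => (HasTwoJet.const 1).add ((HasTwoJet.const (-1)).mul
      (hasTwoJet_norm_sq x x₀ i))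
    have k0 := (((((jz 0).mul (jz 0)).mul ((jp0.mul jp0).add (jq0.mul jq0))).add
      ((HasTwoJet.const (lam + 21)).mul (ju0.mul ju0))).eq_zero_and_nonpos_of_isLocalMax
        (hGmax.comp_planeBasis 0)).2
    have k1 := (((((jz 1).mul (jz 1)).mul ((jp1.mul jp1).add (jq1.mul jq1))).add
      ((HasTwoJet.const (lam + 21)).mul (ju1.mul ju1))).eq_zero_and_nonpos_of_isLocalMax
        (hGmax.comp_planeBasis 1)).2
    simp only [zero_smul, add_zero] at k0 k1
    have hn := plane_norm_sq (x - x₀)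
    have := bernstein_inequality (z := 1 + -1 * ‖x - x₀‖ ^ 2) (y₀ := (x - x₀) 0)
      (y₁ := (x - x₀) 1) (b := b) hlam (by rw [hn]; ring) (by linarith) hT0 hT1 htr
      ((le_of_eq (by ring)).trans (add_nonpos k0 k1))
    rw [← h.fst_eq x hxΩ, ← h.snd_eq x hxΩ] at this
    have h4 := mul_le_mul_of_nonneg_left huM2 (by positivity : 0 ≤ (lam + 21) * lam)
    linarith [sq_nonneg α]

/-! ### The `P`-function -/

/-- At a critical point of `|∇u|² + lam u² + δ u - ε |x - x₀|²`, with `r = ε (x - x₀)`, the Hessian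
in the unit direction of `∇u` takes the value `m = s - (lam u + δ/2)`. In dimension two, `m` and the
trace bound the determinant above, hence `|D²u|²` below, and the Laplacian condition then forces `ε`
to be large compared with `δ²`. -/
theorem pFunction_inequality {a b c p q u lam δ ε r₀ r₁ s T00 T01 T10 T11 : ℝ}
    (hlam : 0 < lam) (hδ : 0 < δ) (hu : 0 ≤ u)
    (hN : 0 < p ^ 2 + q ^ 2) (hs : s * (p ^ 2 + q ^ 2) = r₀ * p + r₁ * q) (hs' : |s| ≤ δ / 4)
    (hT0 : T00 + T10 = -lam * p) (hT1 : T01 + T11 = -lam * q) (htr : a + c = -lam * u)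
    (h0 : 2 * (p * a + q * b) + (2 * lam * u + δ) * p - 2 * r₀ = 0)
    (h1 : 2 * (p * b + q * c) + (2 * lam * u + δ) * q - 2 * r₁ = 0)
    (h2 : 2 * (a ^ 2 + p * T00 + b ^ 2 + q * T01) + 2 * lam * (p ^ 2 + u * a) + δ * a +
      (2 * (b ^ 2 + p * T10 + c ^ 2 + q * T11) + 2 * lam * (q ^ 2 + u * c) + δ * c) ≤ 4 * ε) :
    δ ^ 2 / 16 ≤ ε := by
  obtain rfl : T10 = -lam * p - T00 := by linarith
  obtain rfl : T11 = -lam * q - T01 := by linarith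
  have hm : (a * p ^ 2 + 2 * b * p * q + c * q ^ 2) = (s - (lam * u + δ / 2)) * (p ^ 2 + q ^ 2) := by
    linear_combination (p / 2) * h0 + (q / 2) * h1 - hs
  set m := s - (lam * u + δ / 2) with hm'
  have hdet : (a * c - b ^ 2) ≤ m * (-lam * u - m) := by
    -- The square on the right is that of the off-diagonal Hessian entry in the frame along `∇u`, up
    -- to scaling.
    have e : (m * (-lam * u - m) - (a * c - b ^ 2)) * (p ^ 2 + q ^ 2) ^ 2 =
        (b * (p ^ 2 - q ^ 2) + (c - a) * p * q) ^ 2 := by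
      rw [← htr]
      linear_combination (-(a + c - m) * (p ^ 2 + q ^ 2) +
        (a * p ^ 2 + 2 * b * p * q + c * q ^ 2)) * hm
    by_contra! hlt
    have : (m * (-lam * u - m) - (a * c - b ^ 2)) * (p ^ 2 + q ^ 2) ^ 2 < 0 :=
      mul_neg_of_neg_of_pos (by linarith) (by positivity)
    rw [e] at this
    exact absurd this (not_lt.mpr (sq_nonneg _))
  have hsq : a ^ 2 + 2 * b ^ 2 + c ^ 2 = (lam * u) ^ 2 - 2 * (a * c - b ^ 2) := by
    linear_combination (a + c - lam * u) * htr
  obtain ⟨hs1, hs2⟩ := abs_le.mp hs'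
  have key : 4 * (δ / 2 - s) ^ 2 + lam * u * (δ - 4 * s) ≤ 4 * ε := by
    have : 2 * (a ^ 2 + 2 * b ^ 2 + c ^ 2) - (2 * lam * u + δ) * (lam * u) ≤ 4 * ε := by
      nlinarith
    rw [hsq] at this
    simp only [hm'] at hdet
    nlinarith
  have : 0 ≤ lam * u * (δ - 4 * s) := by
    apply mul_nonneg (by positivity); linarith
  nlinarith

/-- The `P`-function bound: for small `δ`, `|∇u|² + lam u² + δ u` does not exceed its boundary
value. -/
theorem IsHelmholtzWithConstantGradient.pFunction_le {Ω : Set Plane} {lam α M δ : ℝ}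
    {u p q : Plane → ℝ} (h : IsHelmholtzWithConstantGradient Ω lam α M u p q) (hlam : 0 < lam)
    (hδ : 0 < δ) (hM : lam * M ^ 2 + δ * M < α ^ 2) {x₀ : Plane} (hx₀ : x₀ ∈ Ω) :
    p x₀ ^ 2 + q x₀ ^ 2 + lam * u x₀ ^ 2 + δ * u x₀ ≤ α ^ 2 := by
  by_contra! hgt
  obtain ⟨B, hB⟩ := h.exists_gradient_bound hlam
  set c₀ := α ^ 2 - (lam * M ^ 2 + δ * M) with hc₀
  have hc₀pos : 0 < c₀ := by linarith
  have hM0 : 0 ≤ M := (h.nonneg x₀ (subset_closure hx₀)).trans (h.le x₀ (subset_closure hx₀))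
  have hB0 : 0 ≤ B := (by positivity : 0 ≤ p x₀ ^ 2 + q x₀ ^ 2).trans
    (hB x₀ (subset_closure hx₀))
  set A := B + α ^ 2 + 1 with hA
  have hA0 : 0 < A := by positivity
  -- The first bound contradicts `pFunction_inequality`. The second gives `|s| ≤ δ/4`, since `ε² |x
  -- - x₀|² ≤ ε A` in the ball of radius `R`, where `ε R² = A`.
  obtain ⟨ε, hε, hε1, hε2⟩ : ∃ ε : ℝ, 0 < ε ∧ ε < δ ^ 2 / 16 ∧ ε * A ≤ c₀ * (δ / 4) ^ 2 := by
    refine ⟨min (δ ^ 2 / 32) (c₀ * (δ / 4) ^ 2 / A), by positivity, ?_, ?_⟩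
    · exact (min_le_left _ _).trans_lt (by nlinarith [sq_pos_of_pos hδ])
    · exact (mul_le_mul_of_nonneg_right (min_le_right _ _) hA0.le).trans_eq (by field_simp)
  set R := Real.sqrt (A / ε) with hR
  have hR2 : ε * R ^ 2 = A := by rw [hR, Real.sq_sqrt (by positivity)]; field_simp
  have hRpos : 0 < R := Real.sqrt_pos.mpr (by positivity)
  set F : Plane → ℝ := fun x => (p x * p x + q x * q x) + lam * (u x * u x) + δ * u x +
    -ε * ‖x - x₀‖ ^ 2 with hF
  have hFc : ContinuousOn F (closure Ω) := by
    have h1 := h.continuousOn; have h2 := h.continuousOn_fst; have h3 := h.continuousOn_snd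
    fun_prop
  obtain ⟨x, hxc, hFx, hxR, hcase⟩ :=
    exists_max_closure_inter_closedBall h.isOpen hFc hx₀ hRpos
  have hgt' : α ^ 2 < F x := by
    refine lt_of_lt_of_le ?_ hFx
    simp only [hF, sub_self, norm_zero]
    nlinarith
  have hu0 := h.nonneg x hxc
  have huM := h.le x hxc
  have huM2 : lam * u x ^ 2 + δ * u x ≤ lam * M ^ 2 + δ * M := by gcongr
  rcases hcase with hxf | hxR | ⟨hxΩ, hmax⟩
  · have : 0 ≤ ε * ‖x - x₀‖ ^ 2 := by positivity
    simp only [hF, h.dirichlet x hxf] at hgt'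
    nlinarith [h.gradient x hxf]
  · simp only [hF, hxR] at hgt'
    nlinarith [hB x hxc, sq_nonneg α]
  · obtain ⟨a, b, c, T00, T01, T10, T11, ju0, ju1, jp0, jp1, jq0, jq1, htr, hT0, hT1⟩ :=
      exists_twoJets_of_helmholtz h.isOpen h.contDiffOn h.equation hxΩ
    set G : Plane → ℝ := fun x => (partialDeriv 0 u x * partialDeriv 0 u x +
      partialDeriv 1 u x * partialDeriv 1 u x) + lam * (u x * u x) + δ * u x +
      -ε * ‖x - x₀‖ ^ 2 with hG
    have hGmax : IsLocalMax G x := hmax.congr (by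
      filter_upwards [h.isOpen.mem_nhds hxΩ] with y hy
      simp only [hF, hG, h.fst_eq y hy, h.snd_eq y hy])
    have k0 := (((((jp0.mul jp0).add (jq0.mul jq0)).add
      ((HasTwoJet.const lam).mul (ju0.mul ju0))).add ((HasTwoJet.const δ).mul ju0)).add
      ((HasTwoJet.const (-ε)).mul (hasTwoJet_norm_sq x x₀ 0))).eq_zero_and_nonpos_of_isLocalMax
        (hGmax.comp_planeBasis 0)
    have k1 := (((((jp1.mul jp1).add (jq1.mul jq1)).add
      ((HasTwoJet.const lam).mul (ju1.mul ju1))).add ((HasTwoJet.const δ).mul ju1)).add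
      ((HasTwoJet.const (-ε)).mul (hasTwoJet_norm_sq x x₀ 1))).eq_zero_and_nonpos_of_isLocalMax
        (hGmax.comp_planeBasis 1)
    simp only [zero_smul, add_zero] at k0 k1
    have hp := h.fst_eq x hxΩ
    have hq := h.snd_eq x hxΩ
    rw [← hp] at k0 k1 hT0
    rw [← hq] at k0 k1 hT1
    have hn := plane_norm_sq (x - x₀)
    have hn2 : ‖x - x₀‖ ^ 2 ≤ R ^ 2 := by gcongr
    set N := p x ^ 2 + q x ^ 2 with hNdef
    -- As `F x > α²` and the terms in `u` are at most `α² - c₀`, the gradient cannot be small here.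
    have hNc : c₀ ≤ N := by
      have : 0 ≤ ε * ‖x - x₀‖ ^ 2 := by positivity
      have e : F x = N + (lam * u x ^ 2 + δ * u x) - ε * ‖x - x₀‖ ^ 2 := by
        simp only [hF, hNdef]; ring
      linarith
    have hNpos : 0 < N := hc₀pos.trans_le hNc
    set r₀ := ε * (x - x₀) 0 with hr₀
    set r₁ := ε * (x - x₀) 1 with hr₁
    have hr : r₀ ^ 2 + r₁ ^ 2 ≤ N * (δ / 4) ^ 2 := by
      have e1 : r₀ ^ 2 + r₁ ^ 2 = ε * (ε * ‖x - x₀‖ ^ 2) := by rw [hn]; ring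
      rw [e1]
      calc ε * (ε * ‖x - x₀‖ ^ 2) ≤ ε * (ε * R ^ 2) := by gcongr
        _ = ε * A := by rw [hR2]
        _ ≤ c₀ * (δ / 4) ^ 2 := hε2
        _ ≤ N * (δ / 4) ^ 2 := by gcongr
    have hs : |(r₀ * p x + r₁ * q x) / N| ≤ δ / 4 := by
      rw [abs_div, abs_of_pos hNpos, div_le_iff₀ hNpos]
      apply abs_le_of_sq_le_sq _ (by positivity)
      have : (r₀ * p x + r₁ * q x) ^ 2 ≤ (r₀ ^ 2 + r₁ ^ 2) * N := by
        rw [hNdef]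
        linarith [sq_nonneg (r₀ * q x - r₁ * p x)]
      calc (r₀ * p x + r₁ * q x) ^ 2 ≤ (r₀ ^ 2 + r₁ ^ 2) * N := this
        _ ≤ N * (δ / 4) ^ 2 * N := mul_le_mul_of_nonneg_right hr hNpos.le
        _ = (δ / 4 * N) ^ 2 := by ring
    have := pFunction_inequality (b := b) (ε := ε) (r₀ := r₀) (r₁ := r₁) hlam hδ hu0 hNpos
      (div_mul_cancel₀ _ hNpos.ne') hs hT0 hT1 htr
      (by linarith [k0.1]) (by linarith [k1.1]) (by linarith [k0.2, k1.2])
    linarith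

/-! ### First-order analysis at the boundary -/

section Boundary

variable {Ω : Set Plane} {p : Plane} {φ : Plane → ℝ}

theorem fderiv_apply_eq_inner_gradient {f : Plane → ℝ} {x v : Plane} :
    fderiv ℝ f x v = inner ℝ (gradient f x) v := by
  simp [gradient]

theorem IsC2DefiningFunctionAt.differentiableAt (h : IsC2DefiningFunctionAt Ω p φ) :
    DifferentiableAt ℝ φ p := h.contDiffAt.differentiableAt (by norm_num)

theorem IsC2DefiningFunctionAt.eventually_mem (h : IsC2DefiningFunctionAt Ω p φ) {v : Plane}
    (hv : fderiv ℝ φ p v < 0) : ∀ᶠ t in 𝓝[>] (0 : ℝ), p + t • v ∈ Ω := by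
  have hc : Tendsto (fun t : ℝ => p + t • v) (𝓝[>] 0) (𝓝 p) := by
    have : Continuous (fun t : ℝ => p + t • v) := by fun_prop
    simpa using (this.tendsto 0).mono_left nhdsWithin_le_nhds
  have hl : HasDerivAt (fun t : ℝ => p + t • v) v 0 := by
    simpa using ((hasDerivAt_id (0 : ℝ)).smul_const v).const_add p
  have hd : HasDerivAt (fun t : ℝ => φ (p + t • v)) (fderiv ℝ φ p v) 0 := by
    have hφ : HasFDerivAt φ (fderiv ℝ φ p) (p + (0 : ℝ) • v) := by
      simpa using h.differentiableAt.hasFDerivAt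
    exact hφ.comp_hasDerivAt (0 : ℝ) hl
  have hslope := (hasDerivAt_iff_tendsto_slope.mp hd).mono_left
    (nhdsWithin_mono (0 : ℝ) (fun t (ht : 0 < t) => ht.ne'))
  filter_upwards [hc.eventually h.mem_iff, hslope.eventually_lt_const hv, self_mem_nhdsWithin]
    with t ht hs ht0
  rw [ht]
  have ht0 : 0 < t := ht0
  simp only [slope_def_field, sub_zero, zero_smul, add_zero, h.eq_zero] at hs
  by_contra! hcon
  exact absurd hs (not_lt.mpr (div_nonneg hcon ht0.le))

theorem IsC2DefiningFunctionAt.mem_posTangentConeAt (h : IsC2DefiningFunctionAt Ω p φ)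
    {v : Plane} (hv : fderiv ℝ φ p v < 0) : v ∈ posTangentConeAt (closure Ω) p :=
  mem_posTangentConeAt_of_frequently_mem
    ((h.eventually_mem hv).mono fun _ ht => subset_closure ht).frequently

theorem IsC2DefiningFunctionAt.exists_fderiv_neg (h : IsC2DefiningFunctionAt Ω p φ) :
    fderiv ℝ φ p (-gradient φ p) < 0 := by
  rw [fderiv_apply_eq_inner_gradient, inner_neg_right, real_inner_self_eq_norm_sq]
  have := norm_pos_iff.mpr h.gradient_ne_zero
  nlinarith

/-- Inward directions lie in the tangent cone and span the plane: every vector becomes inward after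
adding a multiple of one inward `n`. -/
theorem uniqueDiffOn_closure (hΩ : IsOpen Ω) (hb : HasC2Boundary Ω) :
    UniqueDiffOn ℝ (closure Ω) := by
  intro x hx
  by_cases hxΩ : x ∈ Ω
  · exact uniqueDiffWithinAt_of_mem_nhds (mem_of_superset (hΩ.mem_nhds hxΩ) subset_closure)
  obtain ⟨φ, h⟩ := hb x ⟨hx, by rwa [hΩ.interior_eq]⟩
  refine ⟨?_, by rwa [closure_closure]⟩
  suffices hs : Submodule.span ℝ (tangentConeAt ℝ (closure Ω) x) = ⊤ by
    rw [hs]; simp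
  have hcone : ∀ v : Plane, fderiv ℝ φ x v < 0 →
      v ∈ Submodule.span ℝ (tangentConeAt ℝ (closure Ω) x) := fun v hv =>
    Submodule.subset_span (tangentConeAt_mono_field (h.mem_posTangentConeAt hv))
  rw [eq_top_iff]
  intro v _
  have hn := h.exists_fderiv_neg
  set n := -gradient φ x
  by_cases hv : fderiv ℝ φ x v < 0
  · exact hcone v hv
  push Not at hv
  have hk : fderiv ℝ φ x (v + ((fderiv ℝ φ x v + 1) / -fderiv ℝ φ x n) • n) < 0 := by
    rw [map_add, map_smul, smul_eq_mul]
    have : (fderiv ℝ φ x v + 1) / -fderiv ℝ φ x n * fderiv ℝ φ x n = -(fderiv ℝ φ x v + 1) := by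
      field_simp [hn.ne]
    linarith
  have := Submodule.sub_mem _ (hcone _ hk) (Submodule.smul_mem _
    ((fderiv ℝ φ x v + 1) / -fderiv ℝ φ x n) (hcone n hn))
  simpa using this

/-- Strictly inward vectors lie in the tangent cone of the closure, where the minimum at `p` gives
the sign; vectors tangent to the boundary are limits of these. -/
theorem fderivWithin_nonneg_of_fderiv_nonpos {u : Plane → ℝ} (h : IsC2DefiningFunctionAt Ω p φ)
    (hu : DifferentiableWithinAt ℝ u (closure Ω) p) (hmin : ∀ x ∈ closure Ω, u p ≤ u x)
    {v : Plane} (hv : fderiv ℝ φ p v ≤ 0) : 0 ≤ fderivWithin ℝ u (closure Ω) p v := by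
  have hcone : ∀ w : Plane, fderiv ℝ φ p w < 0 → 0 ≤ fderivWithin ℝ u (closure Ω) p w :=
    fun w hw => IsLocalMinOn.hasFDerivWithinAt_nonneg
      (Filter.eventually_of_mem self_mem_nhdsWithin hmin) hu.hasFDerivWithinAt
      (h.mem_posTangentConeAt hw)
  have hn := h.exists_fderiv_neg
  set n := -gradient φ p
  have hlim : Tendsto (fun η : ℝ => fderivWithin ℝ u (closure Ω) p (v + η • n)) (𝓝[>] 0)
      (𝓝 (fderivWithin ℝ u (closure Ω) p v)) := by
    have : Continuous fun η : ℝ => fderivWithin ℝ u (closure Ω) p (v + η • n) := by fun_prop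
    simpa using (this.tendsto 0).mono_left nhdsWithin_le_nhds
  refine ge_of_tendsto hlim ?_
  filter_upwards [self_mem_nhdsWithin] with η hη
  refine hcone _ ?_
  have hη : 0 < η := hη
  rw [map_add, map_smul, smul_eq_mul]
  nlinarith [mul_neg_of_pos_of_neg hη hn]

/-- On the boundary the gradient of a nonnegative function vanishing there is normal. -/
theorem fderivWithin_eq_mul_inner {u : Plane → ℝ} (h : IsC2DefiningFunctionAt Ω p φ)
    (hu : DifferentiableWithinAt ℝ u (closure Ω) p) (hmin : ∀ x ∈ closure Ω, u p ≤ u x)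
    (v : Plane) :
    fderivWithin ℝ u (closure Ω) p v =
      fderivWithin ℝ u (closure Ω) p (‖gradient φ p‖⁻¹ • gradient φ p) *
        inner ℝ (‖gradient φ p‖⁻¹ • gradient φ p) v := by
  have hg := norm_pos_iff.mpr h.gradient_ne_zero
  set g := gradient φ p with hgdef
  set ν := ‖g‖⁻¹ • g with hν
  have hνν : inner ℝ ν ν = (1 : ℝ) := by
    rw [hν, inner_smul_left, inner_smul_right, real_inner_self_eq_norm_sq]
    simp; field_simp
  have hgν : g = ‖g‖ • ν := by rw [hν, smul_smul, mul_inv_cancel₀ hg.ne', one_smul]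
  set τ := v - (inner ℝ ν v : ℝ) • ν with hτ
  have hφτ : fderiv ℝ φ p τ = 0 := by
    rw [fderiv_apply_eq_inner_gradient, ← hgdef, hgν, inner_smul_left, hτ, inner_sub_right,
      inner_smul_right, hνν]
    simp
  have h1 := fderivWithin_nonneg_of_fderiv_nonpos h hu hmin (v := τ) hφτ.le
  have h2 := fderivWithin_nonneg_of_fderiv_nonpos h hu hmin (v := -τ) (by simp [hφτ])
  rw [map_neg] at h2
  have h3 : fderivWithin ℝ u (closure Ω) p τ = 0 := by linarith
  rw [hτ, map_sub, map_smul, smul_eq_mul] at h3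
  linarith

theorem IsOutwardUnitNormal.norm_eq_one {ν : Plane} (h : IsOutwardUnitNormal Ω p ν) : ‖ν‖ = 1 := by
  obtain ⟨φ, hφ, rfl⟩ := h
  rw [norm_smul, norm_inv, norm_norm, inv_mul_cancel₀ (norm_ne_zero_iff.mpr hφ.gradient_ne_zero)]

end Boundary

theorem plane_eq_basis (x : Plane) : x = x 0 • planeBasis 0 + x 1 • planeBasis 1 := by
  ext i
  fin_cases i <;> simp [planeBasis]

theorem inner_planeBasis (x : Plane) (i : Fin 2) : inner ℝ x (planeBasis i) = x i := by
  simp [planeBasis, EuclideanSpace.inner_single_right]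

theorem plane_inner (x y : Plane) : inner ℝ x y = x 0 * y 0 + x 1 * y 1 := by
  simp [PiLp.inner_apply, Fin.sum_univ_two]
  ring

theorem bilin_eq_coord (B : Plane →L[ℝ] Plane →L[ℝ] ℝ) (x y : Plane) :
    B x y = x 0 * (y 0 * B (planeBasis 0) (planeBasis 0) + y 1 * B (planeBasis 0) (planeBasis 1)) +
      x 1 * (y 0 * B (planeBasis 1) (planeBasis 0) + y 1 * B (planeBasis 1) (planeBasis 1)) := by
  conv_lhs => rw [plane_eq_basis x, plane_eq_basis y]
  simp

theorem mem_or_mem_frontier_of_mem_closure {Ω : Set Plane} (hΩ : IsOpen Ω) {x : Plane}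
    (hx : x ∈ closure Ω) : x ∈ Ω ∨ x ∈ frontier Ω := by
  by_cases h : x ∈ Ω
  · exact Or.inl h
  · exact Or.inr ⟨hx, by rwa [hΩ.interior_eq]⟩

/-! ### Positivity of the boundary curvature -/

namespace IsOverdeterminedSolution

variable {Ω : Set Plane} {lam α : ℝ} {u : Plane → ℝ}

theorem nonneg (hu : IsOverdeterminedSolution Ω lam α u) (hΩ : IsOpen Ω) :
    ∀ x ∈ closure Ω, 0 ≤ u x := by
  intro x hx
  rcases mem_or_mem_frontier_of_mem_closure hΩ hx with h | h
  · exact (hu.pos x h).le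
  · exact (hu.dirichlet x h).ge

theorem differentiableWithinAt (hu : IsOverdeterminedSolution Ω lam α u) {x : Plane}
    (hx : x ∈ closure Ω) : DifferentiableWithinAt ℝ u (closure Ω) x :=
  (hu.contDiffOn_closure.differentiableOn (by norm_num)) x hx

theorem fderivWithin_frontier (hu : IsOverdeterminedSolution Ω lam α u) (hΩ : IsOpen Ω)
    {p ν : Plane} (hp : p ∈ frontier Ω) (hν : IsOutwardUnitNormal Ω p ν) (v : Plane) :
    fderivWithin ℝ u (closure Ω) p v = α * inner ℝ ν v := by
  obtain ⟨φ, hφ, rfl⟩ := id hν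
  rw [fderivWithin_eq_mul_inner hφ (hu.differentiableWithinAt (frontier_subset_closure hp))
    (fun x hx => by rw [hu.dirichlet p hp]; exact hu.nonneg hΩ x hx) v, hu.neumann p hp _ hν]

theorem fderivWithin_eq_fderiv (hΩ : IsOpen Ω) {x : Plane} (hx : x ∈ Ω) :
    fderivWithin ℝ u (closure Ω) x = fderiv ℝ u x :=
  fderivWithin_of_mem_nhds (mem_of_superset (hΩ.mem_nhds hx) subset_closure)

theorem contDiffOn_fderivWithin (hu : IsOverdeterminedSolution Ω lam α u) (hΩ : IsOpen Ω)
    (hb : HasC2Boundary Ω) : ContDiffOn ℝ 1 (fderivWithin ℝ u (closure Ω)) (closure Ω) :=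
  hu.contDiffOn_closure.fderivWithin (uniqueDiffOn_closure hΩ hb) (by norm_num)

theorem isHelmholtzWithConstantGradient (hu : IsOverdeterminedSolution Ω lam α u)
    (hΩ : IsOpen Ω) (hb : HasC2Boundary Ω) {M : ℝ} (hM0 : 0 ≤ M) (hM : ∀ x ∈ Ω, u x ≤ M) :
    IsHelmholtzWithConstantGradient Ω lam α M u
      (fun x => fderivWithin ℝ u (closure Ω) x (planeBasis 0))
      (fun x => fderivWithin ℝ u (closure Ω) x (planeBasis 1)) where
  isOpen := hΩ
  contDiffOn := hu.contDiffOn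
  equation := hu.equation
  nonneg := hu.nonneg hΩ
  le x hx := by
    rcases mem_or_mem_frontier_of_mem_closure hΩ hx with h | h
    · exact hM x h
    · rwa [hu.dirichlet x h]
  continuousOn := hu.contDiffOn_closure.continuousOn
  continuousOn_fst := (hu.contDiffOn_fderivWithin hΩ hb).continuousOn.clm_apply continuousOn_const
  continuousOn_snd := (hu.contDiffOn_fderivWithin hΩ hb).continuousOn.clm_apply continuousOn_const
  fst_eq x hx := by rw [fderivWithin_eq_fderiv hΩ hx]; rfl
  snd_eq x hx := by rw [fderivWithin_eq_fderiv hΩ hx]; rfl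
  dirichlet := hu.dirichlet
  gradient x hx := by
    obtain ⟨φ, hφ⟩ := hb x hx
    have hν : IsOutwardUnitNormal Ω x (‖gradient φ x‖⁻¹ • gradient φ x) := ⟨φ, hφ, rfl⟩
    have hn := plane_norm_sq (‖gradient φ x‖⁻¹ • gradient φ x)
    rw [hν.norm_eq_one] at hn
    rw [hu.fderivWithin_frontier hΩ hx hν, hu.fderivWithin_frontier hΩ hx hν, inner_planeBasis,
      inner_planeBasis]
    linear_combination -α ^ 2 * hn

/-- The equation extends to the closure by continuity of the second derivative, and `u = 0` on the
boundary. -/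
theorem trace_fderivWithin_frontier (hu : IsOverdeterminedSolution Ω lam α u) (hΩ : IsOpen Ω)
    (hb : HasC2Boundary Ω) {p : Plane} (hp : p ∈ frontier Ω) :
    fderivWithin ℝ (fderivWithin ℝ u (closure Ω)) (closure Ω) p (planeBasis 0) (planeBasis 0) +
      fderivWithin ℝ (fderivWithin ℝ u (closure Ω)) (closure Ω) p (planeBasis 1) (planeBasis 1)
        = 0 := by
  have hc : ContinuousOn (fderivWithin ℝ (fderivWithin ℝ u (closure Ω)) (closure Ω)) (closure Ω) :=
    (hu.contDiffOn_fderivWithin hΩ hb).continuousOn_fderivWithin (uniqueDiffOn_closure hΩ hb) le_rfl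
  have hi : ∀ i : Fin 2, ContinuousOn (fun x => fderivWithin ℝ (fderivWithin ℝ u (closure Ω))
      (closure Ω) x (planeBasis i) (planeBasis i)) (closure Ω) := fun i =>
    (hc.clm_apply continuousOn_const).clm_apply continuousOn_const
  have heq : EqOn (fun x => fderivWithin ℝ (fderivWithin ℝ u (closure Ω)) (closure Ω) x
      (planeBasis 0) (planeBasis 0) + fderivWithin ℝ (fderivWithin ℝ u (closure Ω)) (closure Ω) x
      (planeBasis 1) (planeBasis 1)) (fun x => -lam * u x) (closure Ω) := by
    refine EqOn.of_subset_closure ?_ ((hi 0).add (hi 1))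
      (hu.contDiffOn_closure.continuousOn.const_smul (-lam)) subset_closure subset_rfl
    intro x hx
    have h2 : ContDiffAt ℝ 2 u x :=
      (hu.contDiffOn.contDiffAt (hΩ.mem_nhds hx)).of_le (by norm_num)
    have h1 := hu.equation x hx
    rw [laplacian_eq_partialDeriv h2, partialDeriv_partialDeriv_eq h2,
      partialDeriv_partialDeriv_eq h2] at h1
    have h3 : fderivWithin ℝ u (closure Ω) =ᶠ[𝓝 x] fderiv ℝ u := by
      filter_upwards [hΩ.mem_nhds hx] with y hy using fderivWithin_eq_fderiv hΩ hy
    have h4 : fderivWithin ℝ (fderivWithin ℝ u (closure Ω)) (closure Ω) x =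
        fderiv ℝ (fderiv ℝ u) x := by
      rw [fderivWithin_of_mem_nhds (mem_of_superset (hΩ.mem_nhds hx) subset_closure), h3.fderiv_eq]
    simp only [h4]
    linarith
  have := heq (frontier_subset_closure hp)
  simpa [hu.dirichlet p hp] using this

/-- The `P`-function bound makes the second normal derivative negative on the boundary. -/
theorem second_normal_derivative_neg (hu : IsOverdeterminedSolution Ω lam α u) (hΩ : IsOpen Ω)
    (hb : HasC2Boundary Ω) (hlam : 0 < lam) (hα : α < 0) {M δ : ℝ} (hM0 : 0 ≤ M)
    (hM : ∀ x ∈ Ω, u x ≤ M) (hδ : 0 < δ) (hMδ : lam * M ^ 2 + δ * M < α ^ 2)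
    {p ν : Plane} (hp : p ∈ frontier Ω) (hν : IsOutwardUnitNormal Ω p ν) :
    fderivWithin ℝ (fderivWithin ℝ u (closure Ω)) (closure Ω) p ν ν < 0 := by
  have H := hu.isHelmholtzWithConstantGradient hΩ hb hM0 hM
  have hpc := frontier_subset_closure hp
  set L := fderivWithin ℝ u (closure Ω) with hL
  set B := fderivWithin ℝ L (closure Ω) p with hB
  have hLd : HasFDerivWithinAt L B (closure Ω) p :=
    (((hu.contDiffOn_fderivWithin hΩ hb).differentiableOn (by norm_num)) p hpc).hasFDerivWithinAt
  have hud : HasFDerivWithinAt u (L p) (closure Ω) p :=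
    (hu.differentiableWithinAt hpc).hasFDerivWithinAt
  have hLe : ∀ i, HasFDerivWithinAt (fun x => L x (planeBasis i)) (B.flip (planeBasis i))
      (closure Ω) p := fun i => by
    simpa using hLd.clm_apply (hasFDerivWithinAt_const (planeBasis i) p (closure Ω))
  have hQ := ((((hLe 0).mul (hLe 0)).add ((hLe 1).mul (hLe 1))).add
    ((hud.mul hud).const_mul lam)).add (hud.const_mul δ)
  have hmax : IsLocalMaxOn (fun x => L x (planeBasis 0) * L x (planeBasis 0) +
      L x (planeBasis 1) * L x (planeBasis 1) + lam * (u x * u x) + δ * u x) (closure Ω) p := by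
    refine Filter.eventually_of_mem self_mem_nhdsWithin fun x hx => ?_
    have h0 := H.gradient p hp
    have hx' : L x (planeBasis 0) ^ 2 + L x (planeBasis 1) ^ 2 + lam * u x ^ 2 + δ * u x
        ≤ α ^ 2 := by
      rcases mem_or_mem_frontier_of_mem_closure hΩ hx with h | h
      · exact H.pFunction_le hlam hδ hMδ h
      · rw [H.gradient x h, hu.dirichlet x h]; simp
    simp only [hu.dirichlet p hp]
    linarith
  have hcone : -ν ∈ posTangentConeAt (closure Ω) p := by
    obtain ⟨φ, hφ, rfl⟩ := id hν
    refine hφ.mem_posTangentConeAt ?_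
    rw [← smul_neg, map_smul, smul_eq_mul]
    exact mul_neg_of_pos_of_neg (inv_pos.mpr (norm_pos_iff.mpr hφ.gradient_ne_zero))
      hφ.exists_fderiv_neg
  -- Since `∇u = α ν` at `p`, this says `-(2 α B(ν, ν) + δ α) ≤ 0`.
  have hle := hmax.hasFDerivWithinAt_nonpos hQ hcone
  have hLν : ∀ v, L p v = α * inner ℝ ν v := hu.fderivWithin_frontier hΩ hp hν
  simp [hu.dirichlet p hp, hLν, hν.norm_eq_one, inner_planeBasis] at hle
  have e2 : B ν ν = ν 0 * B ν (planeBasis 0) + ν 1 * B ν (planeBasis 1) := by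
    simpa only [map_add, map_smul, smul_eq_mul] using congrArg (B ν) (plane_eq_basis ν)
  by_contra! hcon
  have h1 : 0 ≤ -α * B ν ν := mul_nonneg (by linarith) hcon
  have h2 : δ * α < 0 := mul_neg_of_pos_of_neg hδ hα
  rw [e2] at h1
  linarith

/-- Differentiating `u ∘ γ = 0` twice gives `B(w, w) + α ⟨ν, γ''⟩ = 0` with `w = γ'(0)`. Trace zero
gives `B(w, w) = -|w|² B(ν, ν) > 0`, and `α < 0`. -/
theorem hasPositiveBoundaryCurvature (hu : IsOverdeterminedSolution Ω lam α u) (hΩ : IsOpen Ω)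
    (hb : HasC2Boundary Ω) (hne : Ω.Nonempty) (hlam : 0 < lam)
    (hmax : ∃ M : ℝ, M < |α| / Real.sqrt lam ∧ ∀ x ∈ Ω, u x ≤ M) :
    HasPositiveBoundaryCurvature Ω := by
  intro γ ν hγ hγ' hγf hν
  obtain ⟨M, hMα, hM⟩ := hmax
  obtain ⟨x₀, hx₀⟩ := hne
  have hMpos : 0 < M := (hu.pos x₀ hx₀).trans_le (hM x₀ hx₀)
  have hp : γ 0 ∈ frontier Ω := hγf.self_of_nhds
  have hpc := frontier_subset_closure hp
  have hsl := Real.sqrt_pos.mpr hlam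
  have hMα2 : lam * M ^ 2 < α ^ 2 := by
    rw [lt_div_iff₀ hsl] at hMα
    have h1 : (M * Real.sqrt lam) ^ 2 < |α| ^ 2 := by gcongr
    rwa [mul_pow, Real.sq_sqrt hlam.le, sq_abs, mul_comm] at h1
  have hα0 : α ≠ 0 := by
    rintro rfl
    nlinarith [mul_pos hlam (pow_pos hMpos 2)]
  have hLν : ∀ v, fderivWithin ℝ u (closure Ω) (γ 0) v = α * inner ℝ ν v :=
    hu.fderivWithin_frontier hΩ hp hν
  have hνν : inner ℝ ν ν = (1 : ℝ) := by
    rw [real_inner_self_eq_norm_sq, hν.norm_eq_one]; norm_num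
  have hα : α < 0 := by
    refine lt_of_le_of_ne ?_ hα0
    obtain ⟨φ, hφ, hνφ⟩ := id hν
    have h1 := fderivWithin_nonneg_of_fderiv_nonpos hφ (hu.differentiableWithinAt hpc)
      (fun x hx => by rw [hu.dirichlet _ hp]; exact hu.nonneg hΩ x hx) (v := -ν) (by
        rw [hνφ, ← smul_neg, map_smul, smul_eq_mul]
        exact mul_nonpos_of_nonneg_of_nonpos (by positivity) hφ.exists_fderiv_neg.le)
    rw [hLν, inner_neg_right, hνν] at h1
    linarith
  obtain ⟨δ, hδ, hMδ⟩ : ∃ δ : ℝ, 0 < δ ∧ lam * M ^ 2 + δ * M < α ^ 2 := by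
    -- This `δ` spends half of the gap `α² - lam M²`.
    refine ⟨(α ^ 2 - lam * M ^ 2) / (2 * M), div_pos (by linarith) (by linarith), ?_⟩
    have : (α ^ 2 - lam * M ^ 2) / (2 * M) * M = (α ^ 2 - lam * M ^ 2) / 2 := by field_simp
    linarith
  have hBν := hu.second_normal_derivative_neg hΩ hb hlam hα hMpos.le hM hδ hMδ hp hν
  have htr := hu.trace_fderivWithin_frontier hΩ hb hp
  set L := fderivWithin ℝ u (closure Ω) with hL
  set B := fderivWithin ℝ L (closure Ω) (γ 0) with hB
  have hcomp : ∀ᶠ s in 𝓝 (0 : ℝ), L (γ s) (deriv γ s) = 0 := by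
    filter_upwards [hγf.eventually_nhds, hγ.eventually (by simp)] with s hs hds
    have hd : HasDerivAt γ (deriv γ s) s := (hds.differentiableAt (by norm_num)).hasDerivAt
    have hsc := frontier_subset_closure hs.self_of_nhds
    have h1 : HasDerivAt (u ∘ γ) (L (γ s) (deriv γ s)) s :=
      (((hu.differentiableWithinAt hsc).hasFDerivWithinAt.comp_hasDerivWithinAt s
        hd.hasDerivWithinAt (fun t ht => frontier_subset_closure ht)).hasDerivAt
          (s := {t | γ t ∈ frontier Ω}) hs)
    have h2 : u ∘ γ =ᶠ[𝓝 s] fun _ => 0 := hs.mono fun t ht => hu.dirichlet _ ht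
    exact h1.unique ((hasDerivAt_const s (0 : ℝ)).congr_of_eventuallyEq h2)
  have hγ0 : HasDerivAt γ (deriv γ 0) 0 := (hγ.differentiableAt (by norm_num)).hasDerivAt
  have hγ1 : HasDerivAt (deriv γ) (deriv (deriv γ) 0) 0 := by
    have h1 : ContDiffAt ℝ 1 (deriv γ) 0 := by
      have := (hγ.fderiv_right (m := 1) (by norm_num)).clm_apply
        (contDiffAt_const (c := (1 : ℝ)))
      exact this
    exact (h1.differentiableAt (by norm_num)).hasDerivAt
  have hLd : HasFDerivWithinAt L B (closure Ω) (γ 0) :=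
    (((hu.contDiffOn_fderivWithin hΩ hb).differentiableOn (by norm_num)) _ hpc).hasFDerivWithinAt
  have hLγ : HasDerivAt (L ∘ γ) (B (deriv γ 0)) 0 :=
    (hLd.comp_hasDerivWithinAt (0 : ℝ) hγ0.hasDerivWithinAt
      (fun t ht => frontier_subset_closure ht)).hasDerivAt (s := {t | γ t ∈ frontier Ω}) hγf
  have hsum : B (deriv γ 0) (deriv γ 0) + L (γ 0) (deriv (deriv γ) 0) = 0 :=
    (hLγ.clm_apply hγ1).unique ((hasDerivAt_const (0 : ℝ) (0 : ℝ)).congr_of_eventuallyEq hcomp)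
  have hperp := hcomp.self_of_nhds
  rw [hLν] at hsum hperp
  have hperp : inner ℝ ν (deriv γ 0) = (0 : ℝ) := (mul_eq_zero.mp hperp).resolve_left hα0
  unfold curvatureAtZero
  have hw : 0 < ‖deriv γ 0‖ ^ 2 := pow_pos (norm_pos_iff.mpr hγ') 2
  refine div_pos ?_ hw
  rw [real_inner_comm]
  set w := deriv γ 0 with hwdef
  have hwn := plane_norm_sq w
  rw [plane_inner] at hνν hperp
  have ew := bilin_eq_coord B w w
  have eν := bilin_eq_coord B ν ν
  -- Being orthogonal to `ν`, `w` is `k` times `ν` turned by a right angle.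
  set k := w 1 * ν 0 - w 0 * ν 1 with hk
  have hw0 : w 0 = -k * ν 1 := by
    simp only [hk]; linear_combination ν 0 * hperp - w 0 * hνν
  have hw1 : w 1 = k * ν 0 := by
    simp only [hk]; linear_combination ν 1 * hperp - w 1 * hνν
  have hkw : k ^ 2 = ‖w‖ ^ 2 := by
    rw [hwn, hw0, hw1]; linear_combination -k ^ 2 * hνν
  have hBw : B w w = -k ^ 2 * B ν ν := by
    rw [ew, eν, hw0, hw1]
    linear_combination k ^ 2 * (ν 0 * ν 0 + ν 1 * ν 1) * htr
  have hBpos : 0 < B w w := by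
    rw [hBw, hkw]; nlinarith [mul_pos hw (neg_pos.mpr hBν)]
  nlinarith

end IsOverdeterminedSolution

/-! ### From local to global convexity -/

section LocallyConvex

variable {E : Type*} [NormedAddCommGroup E] [NormedSpace ℝ E] {K : Set E}

theorem exists_uniform_convex_inter_ball {S : Set E} (hS : IsCompact S)
    (h : ∀ z ∈ S, ∃ r > 0, Convex ℝ (K ∩ Metric.ball z r)) :
    ∃ r > 0, ∀ z ∈ S, Convex ℝ (K ∩ Metric.ball z r) := by
  choose! ρ hρ hconv using h
  obtain ⟨r, hr, hcov⟩ := lebesgue_number_lemma_of_metric (c := fun z : S => Metric.ball z.1 (ρ z.1))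
    hS (fun _ => Metric.isOpen_ball)
    (fun z hz => mem_iUnion.mpr ⟨⟨z, hz⟩, Metric.mem_ball_self (hρ z hz)⟩)
  refine ⟨r, hr, fun z hz => ?_⟩
  obtain ⟨c, hc⟩ := hcov z hz
  have : K ∩ Metric.ball z r = (K ∩ Metric.ball c.1 (ρ c.1)) ∩ Metric.ball z r := by
    ext y; exact ⟨fun hy => ⟨⟨hy.1, hc hy.2⟩, hy.2⟩, fun hy => ⟨hy.1.1, hy.2⟩⟩
  rw [this]
  exact (hconv c.1 c.2).inter (convex_ball z r)

/-- In a locally convex set, a segment can be rotated slightly about one endpoint, with the other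
endpoint moving along a segment of the set. -/
theorem exists_segment_subset_of_locally_convex
    (hloc : ∀ z ∈ K, ∃ r > 0, Convex ℝ (K ∩ Metric.ball z r)) {x y z : E}
    (hxy : segment ℝ x y ⊆ K) (hyz : segment ℝ y z ⊆ K) :
    ∃ s : ℝ, 0 < s ∧ s ≤ 1 ∧ ∀ a ∈ Icc (0 : ℝ) 1, x + a • (y + s • (z - y) - x) ∈ K := by
  have hcomp : IsCompact (segment ℝ y x) := by
    rw [segment_eq_image']
    exact isCompact_Icc.image (by fun_prop)
  rw [segment_symm] at hxy
  obtain ⟨r, hr, hconv⟩ := exists_uniform_convex_inter_ball hcomp fun w hw => hloc w (hxy hw)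
  rw [segment_eq_image'] at hxy hyz hconv
  have hw : ∀ τ ∈ Icc (0 : ℝ) 1, y + τ • (x - y) ∈ K := fun τ hτ => hxy ⟨τ, hτ, rfl⟩
  obtain ⟨m, hm⟩ := exists_nat_gt (2 * ‖x - y‖ / r)
  have hm0 : (0 : ℝ) < m := lt_of_le_of_lt (by positivity) hm
  set η : ℝ := 1 / m with hη
  have hη0 : 0 < η := by positivity
  have hηr : 2 * η * ‖x - y‖ < r := by
    rw [div_lt_iff₀ hr] at hm
    rw [hη]; field_simp; linarith
  -- The point with parameters `τ`, `σ` lies at `τ` on the segment from `y + σ (z - y)` to `x`. The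
  -- induction advances towards `x` in steps of length `η`, shrinking the range of `σ`.
  have key : ∀ j : ℕ, j ≤ m → ∃ s : ℝ, 0 < s ∧ s ≤ 1 ∧ ∀ τ ∈ Icc (0 : ℝ) (j * η),
      ∀ σ ∈ Icc (0 : ℝ) s, y + τ • (x - y) + (σ * (1 - τ)) • (z - y) ∈ K := by
    intro j
    induction j with
    | zero =>
      refine fun _ => ⟨1, one_pos, le_rfl, fun τ hτ σ hσ => ?_⟩
      obtain rfl : τ = 0 := le_antisymm (by simpa using hτ.2) hτ.1
      exact hyz ⟨σ, hσ, by simp⟩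
    | succ j ih =>
      intro hj
      obtain ⟨s, hs0, hs1, hs⟩ := ih (by omega)
      set τ₀ : ℝ := j * η with hτ₀
      have hτ₀0 : 0 ≤ τ₀ := by positivity
      have hstep : τ₀ + η ≤ 1 := by
        have : ((j + 1 : ℕ) : ℝ) ≤ m := by exact_mod_cast hj
        push_cast at this
        rw [hτ₀, hη]; field_simp; linarith
      have hτ₀1 : 0 < 1 - τ₀ := by linarith
      obtain ⟨s₀, hs₀, hs₀r⟩ : ∃ s₀ : ℝ, 0 < s₀ ∧ s₀ * ‖z - y‖ < r := by
        refine ⟨r / (‖z - y‖ + 1), by positivity, ?_⟩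
        rw [div_mul_eq_mul_div, div_lt_iff₀ (by positivity)]
        nlinarith [norm_nonneg (z - y)]
      -- Halving pays for `σ' ≤ 2 σ` below; `s₀` keeps the displaced point in the ball.
      refine ⟨min s s₀ / 2, by positivity, by linarith [min_le_left s s₀], fun τ hτ σ hσ => ?_⟩
      have hms := min_le_left s s₀
      have hms₀ := min_le_right s s₀
      rcases le_total τ τ₀ with hle | hle
      · exact hs τ ⟨hτ.1, hle⟩ σ ⟨hσ.1, by linarith [hσ.2]⟩
      have hτu : τ ≤ τ₀ + η := by
        have := hτ.2
        push_cast at this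
        rw [hτ₀]; linarith
      rcases (hτu.trans hstep).eq_or_lt with h1 | h1
      · rw [h1]
        simpa using hw 1 (by simp)
      -- The new point is a convex combination of a displaced point at `τ₀`, already in `K`, and the
      -- undisplaced point at `τ₂`. Looking two steps ahead keeps the weight `θ` at least `1/2`,
      -- unless `τ₂ = 1`, where `θ (1 - τ₀) = 1 - τ`.
      set τ₂ := min 1 (τ₀ + 2 * η) with hτ₂
      have hτ₂1 : τ₂ ≤ 1 := min_le_left _ _
      have hτ₂η : τ₂ ≤ τ₀ + 2 * η := min_le_right _ _
      have hττ₂ : τ < τ₂ := lt_min h1 (by linarith)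
      have hd : 0 < τ₂ - τ₀ := by linarith
      set θ := (τ₂ - τ) / (τ₂ - τ₀) with hθ
      have hθ0 : 0 < θ := div_pos (by linarith) hd
      have hθ1 : θ ≤ 1 := (div_le_one hd).mpr (by linarith)
      have hθd : θ * (τ₂ - τ₀) = τ₂ - τ := div_mul_cancel₀ _ hd.ne'
      have hratio : 1 - τ ≤ 2 * (θ * (1 - τ₀)) := by
        rcases min_choice 1 (τ₀ + 2 * η) with hc | hc
        · rw [← hτ₂] at hc
          rw [hc] at hθd
          rw [hθd]; linarith
        · rw [← hτ₂] at hc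
          have : 1 ≤ 2 * θ := by
            rw [hc] at hθd
            by_contra! hlt
            nlinarith
          nlinarith
      set σ' := σ * (1 - τ) / (θ * (1 - τ₀)) with hσ'
      have hθτ : 0 < θ * (1 - τ₀) := by positivity
      have hσ'0 : 0 ≤ σ' := div_nonneg (mul_nonneg hσ.1 (by linarith)) hθτ.le
      have hσ'2 : σ' ≤ 2 * σ := by
        rw [hσ', div_le_iff₀ hθτ]
        nlinarith [mul_le_mul_of_nonneg_left hratio hσ.1]
      have hσ's : σ' ≤ min s s₀ := by linarith [hσ.2]
      have hσ'e : θ * (σ' * (1 - τ₀)) = σ * (1 - τ) := by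
        rw [hσ']; field_simp
      have hA : y + τ₀ • (x - y) + (σ' * (1 - τ₀)) • (z - y) ∈
          K ∩ Metric.ball (y + τ₀ • (x - y)) r := by
        refine ⟨hs τ₀ ⟨hτ₀0, le_rfl⟩ σ' ⟨hσ'0, hσ's.trans hms⟩, ?_⟩
        rw [Metric.mem_ball, dist_eq_norm, add_sub_cancel_left, norm_smul, Real.norm_eq_abs,
          abs_of_nonneg (by positivity)]
        refine lt_of_le_of_lt (mul_le_mul_of_nonneg_right ?_ (norm_nonneg _)) hs₀r
        exact (mul_le_of_le_one_right hσ'0 (by linarith)).trans (hσ's.trans hms₀)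
      have hB : y + τ₂ • (x - y) ∈ K ∩ Metric.ball (y + τ₀ • (x - y)) r := by
        refine ⟨hw τ₂ ⟨by linarith, hτ₂1⟩, ?_⟩
        rw [Metric.mem_ball, dist_eq_norm, add_sub_add_left_eq_sub, ← sub_smul, norm_smul,
          Real.norm_eq_abs, abs_of_pos hd]
        exact lt_of_le_of_lt (mul_le_mul_of_nonneg_right (by linarith) (norm_nonneg _)) hηr
      have hmem := hconv _ ⟨τ₀, ⟨hτ₀0, by linarith⟩, rfl⟩ hA hB hθ0.le (sub_nonneg.mpr hθ1)
        (by ring)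
      have heq : y + τ • (x - y) + (σ * (1 - τ)) • (z - y) =
          θ • (y + τ₀ • (x - y) + (σ' * (1 - τ₀)) • (z - y)) +
            (1 - θ) • (y + τ₂ • (x - y)) := by
        have e1 : τ = θ * τ₀ + (1 - θ) * τ₂ := by linear_combination hθd
        rw [← hσ'e]
        conv_lhs => rw [e1]
        module
      rw [heq]
      exact hmem.1
  obtain ⟨s, hs0, hs1, hs⟩ := key m le_rfl
  refine ⟨s, hs0, hs1, fun a ha => ?_⟩
  have hmη : (m : ℝ) * η = 1 := by rw [hη]; field_simp
  have := hs (1 - a) ⟨by linarith [ha.2], by rw [hmη]; linarith [ha.1]⟩ s ⟨hs0.le, le_rfl⟩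
  convert this using 1
  module

/-- **Tietze–Nakajima theorem**: a closed connected locally convex set is convex. -/
theorem convex_of_isPreconnected_of_locally_convex (hK : IsClosed K) (hconn : IsPreconnected K)
    (hloc : ∀ z ∈ K, ∃ r > 0, Convex ℝ (K ∩ Metric.ball z r)) : Convex ℝ K := by
  rw [convex_iff_segment_subset]
  intro x hx
  -- `C` is the part of `K` visible from `x`; it is closed and relatively open in `K`, so
  -- connectedness gives all of `K`.
  set C : Set E := {y | ∀ a ∈ Icc (0 : ℝ) 1, x + a • (y - x) ∈ K} with hC
  have hCclosed : IsClosed C := by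
    have : C = ⋂ a ∈ Icc (0 : ℝ) 1, (fun y => x + a • (y - x)) ⁻¹' K := by
      ext y; simp [hC]
    rw [this]
    exact isClosed_biInter fun a _ => hK.preimage (by fun_prop)
  have hCseg : ∀ y, y ∈ C ↔ segment ℝ x y ⊆ K := fun y => by
    rw [segment_eq_image', image_subset_iff]; rfl
  have hCK : C ⊆ K := fun y hy => by simpa using hy 1 (by simp)
  have hopen : ∀ y ∈ C, ∃ r > 0, K ∩ Metric.ball y r ⊆ C := by
    intro y hy
    obtain ⟨r, hr, hconv⟩ := hloc y (hCK hy)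
    refine ⟨r, hr, fun z hz => ?_⟩
    have hyz : segment ℝ y z ⊆ K :=
      (hconv.segment_subset ⟨hCK hy, Metric.mem_ball_self hr⟩ hz).trans inter_subset_left
    -- Visibility is continued from `y` to `z`: `T` is closed, and the rotation lemma moves past any
    -- `t < 1` in it.
    set T : Set ℝ := {t | y + t • (z - y) ∈ C} with hT
    have hT1 : (1 : ℝ) ∈ T := by
      refine IsClosed.mem_of_ge_of_forall_exists_gt (a := 0) (b := 1) ?_ (by simpa [hT] using hy)
        zero_le_one ?_
      · exact (hCclosed.preimage (by fun_prop)).inter isClosed_Icc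
      · rintro t ⟨ht, ht0, ht1⟩
        have hseg : segment ℝ (y + t • (z - y)) z ⊆ K := by
          refine Subset.trans ((convex_segment y z).segment_subset ?_ (right_mem_segment ℝ y z)) hyz
          rw [segment_eq_image']
          exact ⟨t, ⟨ht0, ht1.le⟩, rfl⟩
        obtain ⟨s, hs0, hs1, hs⟩ :=
          exists_segment_subset_of_locally_convex hloc ((hCseg _).mp ht) hseg
        refine ⟨t + s * (1 - t), ?_, ?_, ?_⟩
        · have e : y + (t + s * (1 - t)) • (z - y) =
              y + t • (z - y) + s • (z - (y + t • (z - y))) := by module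
          change y + (t + s * (1 - t)) • (z - y) ∈ C
          rw [e]
          exact hs
        · nlinarith [mul_pos hs0 (sub_pos.mpr ht1)]
        · nlinarith
    simpa [hT] using hT1
  choose! ρ hρ hsub using hopen
  have hKC : K ⊆ C := by
    by_contra hnot
    obtain ⟨y, hyK, hyC⟩ := not_subset.mp hnot
    have hxC : x ∈ C := fun a _ => by simpa using hx
    obtain ⟨w, hwK, hwU, hwC⟩ := hconn (⋃ c ∈ C, Metric.ball c (ρ c)) Cᶜ
      (isOpen_biUnion fun _ _ => Metric.isOpen_ball) hCclosed.isOpen_compl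
      (fun w _ => (em (w ∈ C)).imp (fun h => mem_biUnion h (Metric.mem_ball_self (hρ w h))) id)
      ⟨x, hx, mem_biUnion hxC (Metric.mem_ball_self (hρ x hxC))⟩ ⟨y, hyK, hyC⟩
    obtain ⟨c, hc, hwc⟩ := mem_iUnion₂.mp hwU
    exact hwC (hsub c hc ⟨hwK, hwc⟩)
  exact fun y hy => (hCseg y).mp (hKC hy)

end LocallyConvex

/-! ### Local strict convexity of the complement -/

namespace IsC2DefiningFunctionAt

variable {Ω : Set Plane} {p : Plane} {φ : Plane → ℝ}

theorem continuousAt_gradient (h : IsC2DefiningFunctionAt Ω p φ) :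
    ContinuousAt (gradient φ) p := by
  have h1 : ContinuousAt (fderiv ℝ φ) p :=
    (h.contDiffAt.fderiv_right (m := 1) (by norm_num)).continuousAt
  exact (InnerProductSpace.toDual ℝ Plane).symm.continuous.continuousAt.comp h1

theorem eventually_of_eq_zero (h : IsC2DefiningFunctionAt Ω p φ) :
    ∀ᶠ x in 𝓝 p, φ x = 0 → IsC2DefiningFunctionAt Ω x φ := by
  filter_upwards [h.contDiffAt.eventually (by simp),
    h.continuousAt_gradient.eventually_ne h.gradient_ne_zero, h.mem_iff.eventually_nhds]
    with x h1 h2 h3 h4 using ⟨h1, h4, h2, h3⟩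

theorem mem_frontier (h : IsC2DefiningFunctionAt Ω p φ) (hΩ : IsOpen Ω) : p ∈ frontier Ω := by
  refine ⟨?_, ?_⟩
  · have hc : Tendsto (fun t : ℝ => p + t • (-gradient φ p)) (𝓝[>] 0) (𝓝 p) := by
      have : Continuous (fun t : ℝ => p + t • (-gradient φ p)) := by fun_prop
      simpa using (this.tendsto 0).mono_left nhdsWithin_le_nhds
    exact mem_closure_of_tendsto hc (h.eventually_mem h.exists_fderiv_neg)
  · rw [hΩ.interior_eq, h.mem_iff.self_of_nhds, h.eq_zero]
    exact lt_irrefl 0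

/-- Through a boundary point there is a `C²` arc in the boundary with any given tangent vector. -/
theorem exists_arc (h : IsC2DefiningFunctionAt Ω p φ) {w : Plane} (hw : fderiv ℝ φ p w = 0) :
    ∃ γ : ℝ → Plane, ContDiffAt ℝ 2 γ 0 ∧ γ 0 = p ∧ deriv γ 0 = w ∧
      ∀ᶠ s in 𝓝 (0 : ℝ), φ (γ s) = 0 := by
  have hg := norm_pos_iff.mpr h.gradient_ne_zero
  set g := gradient φ p with hgdef
  -- `Φ` straightens the boundary: `⟨g, Φ x⟩ = φ x` and `Φ` has identity derivative at `p`, so its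
  -- local inverse sends the line `s • w`, orthogonal to `g`, into `{φ = 0}`.
  set Φ : Plane → Plane := fun x => (x - p) + ((‖g‖ ^ 2)⁻¹ * (φ x - inner ℝ g (x - p))) • g with hΦ
  have hφΦ : ∀ x, φ x = inner ℝ g (Φ x) := fun x => by
    rw [hΦ, inner_add_right, inner_smul_right, real_inner_self_eq_norm_sq]
    field_simp; ring
  have hC : ContDiffAt ℝ 2 Φ p := by
    have h1 : ContDiffAt ℝ 2 (fun x : Plane => x - p) p := contDiffAt_id.sub contDiffAt_const
    exact h1.add ((contDiffAt_const.mul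
      (h.contDiffAt.sub (contDiffAt_const.inner ℝ h1))).smul contDiffAt_const)
  have hd : HasFDerivAt Φ ((ContinuousLinearEquiv.refl ℝ Plane : Plane ≃L[ℝ] Plane) :
      Plane →L[ℝ] Plane) p := by
    have h1 : HasFDerivAt (fun x : Plane => x - p) (ContinuousLinearMap.id ℝ Plane) p :=
      (hasFDerivAt_id p).sub_const p
    have h2 : HasFDerivAt (fun x : Plane => φ x - inner ℝ g (x - p))
        (0 : Plane →L[ℝ] ℝ) p := by
      have h3 := h.differentiableAt.hasFDerivAt.sub ((innerSL ℝ g).hasFDerivAt.comp p h1)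
      refine h3.congr_fderiv (ContinuousLinearMap.ext fun v => ?_)
      simp [fderiv_apply_eq_inner_gradient, ← hgdef]
    have h4 := h1.add ((h2.const_mul (‖g‖ ^ 2)⁻¹).smul_const g)
    exact h4.congr_fderiv (ContinuousLinearMap.ext fun v => by simp)
  have hΦp : Φ p = 0 := by simp [hΦ, h.eq_zero]
  set Ψ := hC.localInverse hd (by norm_num) with hΨ
  have hΨC : ContDiffAt ℝ 2 Ψ 0 := by
    have := hC.to_localInverse hd (by norm_num)
    rwa [hΦp] at this
  have hstrict : HasStrictFDerivAt Φ ((ContinuousLinearEquiv.refl ℝ Plane : Plane ≃L[ℝ] Plane) :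
      Plane →L[ℝ] Plane) p := hC.hasStrictFDerivAt' hd (by norm_num)
  have hΨ0 : Ψ 0 = p := by
    have := hstrict.localInverse_apply_image
    rwa [hΦp] at this
  have hright : ∀ᶠ y in 𝓝 (0 : Plane), Φ (Ψ y) = y := by
    have := hstrict.eventually_right_inverse
    rwa [hΦp] at this
  have hΨd : HasFDerivAt Ψ (ContinuousLinearMap.id ℝ Plane) 0 := by
    have := hstrict.to_localInverse.hasFDerivAt
    rw [hΦp] at this
    exact this
  have hlin : HasDerivAt (fun s : ℝ => s • w) w 0 := by
    simpa using (hasDerivAt_id (0 : ℝ)).smul_const w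
  refine ⟨fun s => Ψ (s • w), ?_, by simpa using hΨ0, ?_, ?_⟩
  · refine ContDiffAt.comp (0 : ℝ) (g := Ψ) (by simpa using hΨC) (by fun_prop)
  · have hΨd' : HasFDerivAt Ψ (ContinuousLinearMap.id ℝ Plane) ((0 : ℝ) • w) := by
      simpa using hΨd
    exact (hΨd'.comp_hasDerivAt (0 : ℝ) hlin).deriv
  · have hc : Tendsto (fun s : ℝ => s • w) (𝓝 0) (𝓝 0) := by
      simpa using hlin.continuousAt.tendsto
    filter_upwards [hc.eventually hright] with s hs
    rw [hφΦ, hs, inner_smul_right, ← fderiv_apply_eq_inner_gradient, hw, mul_zero]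

/-- Along an arc in the boundary with velocity `w`, the second derivative of `φ ∘ γ = 0` reads
`D²φ(w, w) + Dφ(γ'') = 0`, and positive curvature makes the last term positive. -/
theorem second_fderiv_neg (h : IsC2DefiningFunctionAt Ω p φ) (hΩ : IsOpen Ω)
    (hκ : HasPositiveBoundaryCurvature Ω) {w : Plane} (hw0 : w ≠ 0) (hw : fderiv ℝ φ p w = 0) :
    fderiv ℝ (fderiv ℝ φ) p w w < 0 := by
  obtain ⟨γ, hγ, hγp, hγw, hγφ⟩ := h.exists_arc hw
  have hcont : Tendsto γ (𝓝 0) (𝓝 p) := by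
    simpa [hγp] using hγ.continuousAt.tendsto
  have hpos := hκ γ (‖gradient φ p‖⁻¹ • gradient φ p) hγ (by rwa [hγw]) (by
    filter_upwards [hγφ, hcont.eventually h.eventually_of_eq_zero] with s h1 h2
      using (h2 h1).mem_frontier hΩ) (by rw [hγp]; exact ⟨φ, h, rfl⟩)
  unfold curvatureAtZero at hpos
  have hg := norm_pos_iff.mpr h.gradient_ne_zero
  have hpos' : 0 < fderiv ℝ φ p (deriv (deriv γ) 0) := by
    rw [fderiv_apply_eq_inner_gradient, real_inner_comm]
    have h1 : 0 < ‖deriv γ 0‖ ^ 2 := pow_pos (norm_pos_iff.mpr (by rwa [hγw])) 2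
    have h2 := (div_pos_iff_of_pos_right h1).mp hpos
    rw [inner_smul_right] at h2
    exact (mul_pos_iff_of_pos_left (inv_pos.mpr hg)).mp h2
  have hφ : ∀ᶠ x in 𝓝 p, DifferentiableAt ℝ φ x :=
    (h.contDiffAt.eventually (by simp)).mono fun x hx => hx.differentiableAt (by norm_num)
  have hcomp : ∀ᶠ s in 𝓝 (0 : ℝ), fderiv ℝ φ (γ s) (deriv γ s) = 0 := by
    filter_upwards [hγφ.eventually_nhds, hγ.eventually (by simp), hcont.eventually hφ]
      with s h1 h2 h3
    have hd : HasDerivAt γ (deriv γ s) s := (h2.differentiableAt (by norm_num)).hasDerivAt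
    exact (h3.hasFDerivAt.comp_hasDerivAt s hd).unique
      ((hasDerivAt_const s (0 : ℝ)).congr_of_eventuallyEq h1)
  have hγ0 : HasDerivAt γ w 0 := hγw ▸ (hγ.differentiableAt (by norm_num)).hasDerivAt
  have hγ1 : HasDerivAt (deriv γ) (deriv (deriv γ) 0) 0 := by
    have h1 : ContDiffAt ℝ 1 (deriv γ) 0 :=
      (hγ.fderiv_right (m := 1) (by norm_num)).clm_apply (contDiffAt_const (c := (1 : ℝ)))
    exact (h1.differentiableAt (by norm_num)).hasDerivAt
  have hL : HasFDerivAt (fderiv ℝ φ) (fderiv ℝ (fderiv ℝ φ) p) (γ 0) := by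
    rw [hγp]
    exact ((h.contDiffAt.fderiv_right (m := 1) (by norm_num)).differentiableAt
      (by norm_num)).hasFDerivAt
  have hsum := ((hL.comp_hasDerivAt (0 : ℝ) hγ0).clm_apply hγ1).unique
    ((hasDerivAt_const (0 : ℝ) (0 : ℝ)).congr_of_eventuallyEq hcomp)
  simp only [Function.comp, hγp, hγw] at hsum
  linarith

/-- Off the boundary too, the kernel of `Dφ` is spanned by the rotated gradient `τ`, which varies
continuously. Such points matter because the minimum of `φ` on a chord need not lie on `∂Ω`. -/
theorem eventually_second_fderiv_neg (h : IsC2DefiningFunctionAt Ω p φ) (hΩ : IsOpen Ω)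
    (hκ : HasPositiveBoundaryCurvature Ω) :
    ∀ᶠ z in 𝓝 p, ∀ v : Plane, v ≠ 0 → fderiv ℝ φ z v = 0 →
      fderiv ℝ (fderiv ℝ φ) z v v < 0 := by
  have hd1 : ContDiffAt ℝ 1 (fderiv ℝ φ) p := h.contDiffAt.fderiv_right (by norm_num)
  have hc2 : ContinuousAt (fderiv ℝ (fderiv ℝ φ)) p :=
    (hd1.fderiv_right (m := 0) (by norm_num)).continuousAt
  have hc1 : ContinuousAt (fderiv ℝ φ) p := hd1.continuousAt
  set τ : Plane → Plane := fun z => (-fderiv ℝ φ z (planeBasis 1)) • planeBasis 0 +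
    fderiv ℝ φ z (planeBasis 0) • planeBasis 1 with hτ
  have hcoord : ∀ z v, fderiv ℝ φ z v =
      v 0 * fderiv ℝ φ z (planeBasis 0) + v 1 * fderiv ℝ φ z (planeBasis 1) := fun z v => by
    simpa only [map_add, map_smul, smul_eq_mul] using congrArg (fderiv ℝ φ z) (plane_eq_basis v)
  have hτ0 : ∀ z, τ z 0 = -fderiv ℝ φ z (planeBasis 1) := fun z => by simp [hτ, planeBasis]
  have hτ1 : ∀ z, τ z 1 = fderiv ℝ φ z (planeBasis 0) := fun z => by simp [hτ, planeBasis]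
  have hττ : ∀ z, fderiv ℝ φ z (τ z) = 0 := fun z => by
    rw [hcoord, hτ0, hτ1]; ring
  have hτc : ContinuousAt τ p :=
    ((hc1.clm_apply continuousAt_const).neg.smul continuousAt_const).add
      ((hc1.clm_apply continuousAt_const).smul continuousAt_const)
  have hτp : τ p ≠ 0 := by
    intro h0
    have h1 : fderiv ℝ φ p (planeBasis 1) = 0 := by simpa [h0] using (hτ0 p).symm
    have h2 : fderiv ℝ φ p (planeBasis 0) = 0 := by simpa [h0] using (hτ1 p).symm
    have h3 := h.exists_fderiv_neg
    rw [hcoord, h1, h2] at h3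
    simp at h3
  have hneg : ∀ᶠ z in 𝓝 p, fderiv ℝ (fderiv ℝ φ) z (τ z) (τ z) < 0 :=
    ((hc2.clm_apply hτc).clm_apply hτc).eventually_lt_const
      (h.second_fderiv_neg hΩ hκ hτp (hττ p))
  filter_upwards [hneg, hτc.eventually_ne hτp] with z hz hτz v hv hvz
  set a := fderiv ℝ φ z (planeBasis 0) with ha
  set b := fderiv ℝ φ z (planeBasis 1) with hb
  have hN : 0 < a ^ 2 + b ^ 2 := by
    have := plane_norm_sq (τ z)
    rw [hτ0, hτ1, ← ha, ← hb] at this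
    have h1 : 0 < ‖τ z‖ ^ 2 := pow_pos (norm_pos_iff.mpr hτz) 2
    linarith
  rw [hcoord, ← ha, ← hb] at hvz
  have hvτ : v = ((v 1 * a - v 0 * b) / (a ^ 2 + b ^ 2)) • τ z := by
    ext i
    fin_cases i
    · simp [hτ0, ← hb]
      field_simp
      linear_combination a * hvz
    · simp [hτ1, ← ha]
      field_simp
      linear_combination b * hvz
  set k := (v 1 * a - v 0 * b) / (a ^ 2 + b ^ 2) with hk
  have hk0 : k ≠ 0 := by
    intro h0
    rw [h0, zero_smul] at hvτ
    exact hv hvτ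
  rw [hvτ]
  simp only [map_smul, _root_.smul_apply, smul_eq_mul]
  rw [← mul_assoc]
  exact mul_neg_of_pos_of_neg (mul_self_pos.mpr hk0) hz

theorem _root_.ContDiffAt.hasTwoJet_line {f : Plane → ℝ} {x : Plane} (h : ContDiffAt ℝ 2 f x)
    (v : Plane) : HasTwoJet (fun t : ℝ => f (x + t • v)) (fderiv ℝ f x v)
      (fderiv ℝ (fderiv ℝ f) x v v) := by
  have hl : ∀ t : ℝ, HasDerivAt (fun t : ℝ => x + t • v) v t := fun t => by
    simpa using ((hasDerivAt_id t).smul_const v).const_add x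
  have hc : Tendsto (fun t : ℝ => x + t • v) (𝓝 0) (𝓝 x) := by
    simpa using (hl 0).continuousAt.tendsto
  have h1 : ∀ᶠ y in 𝓝 x, DifferentiableAt ℝ f y :=
    (h.eventually (by simp)).mono fun y hy => hy.differentiableAt (by norm_num)
  refine ⟨fun t => fderiv ℝ f (x + t • v) v, ?_, by simp, ?_⟩
  · exact (hc.eventually h1).mono fun t ht => ht.hasFDerivAt.comp_hasDerivAt t (hl t)
  · have h2 : HasFDerivAt (fderiv ℝ f) (fderiv ℝ (fderiv ℝ f) x) (x + (0 : ℝ) • v) := by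
      simpa using ((h.fderiv_right (m := 1) (by norm_num)).differentiableAt
        (by norm_num)).hasFDerivAt
    have h3 : HasDerivAt (fun t : ℝ => fderiv ℝ f (x + t • v)) (fderiv ℝ (fderiv ℝ f) x v) 0 :=
      h2.comp_hasDerivAt (0 : ℝ) (hl 0)
    exact (h3.clm_apply (hasDerivAt_const (0 : ℝ) v)).congr_deriv (by rw [map_zero, add_zero])

/-- Near a boundary point the complement of `Ω` is strictly convex. -/
theorem exists_ball_openSegment_subset (h : IsC2DefiningFunctionAt Ω p φ) (hΩ : IsOpen Ω)
    (hκ : HasPositiveBoundaryCurvature Ω) :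
    ∃ r > 0, ∀ x ∈ Ωᶜ ∩ Metric.ball p r, ∀ y ∈ Ωᶜ ∩ Metric.ball p r, x ≠ y →
      openSegment ℝ x y ⊆ interior Ωᶜ := by
  obtain ⟨r, hr, hball⟩ := Metric.eventually_nhds_iff_ball.mp
    ((h.mem_iff.and (h.contDiffAt.eventually (by simp))).and
      (h.eventually_second_fderiv_neg hΩ hκ))
  refine ⟨r, hr, fun x hx y hy hxy z hz => ?_⟩
  have hcv := convex_ball p r
  have hnonneg : ∀ w ∈ Ωᶜ ∩ Metric.ball p r, 0 ≤ φ w := fun w hw => by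
    by_contra! hlt
    exact hw.1 (((hball w hw.2).1.1).mpr hlt)
  have hline : ∀ t ∈ Icc (0 : ℝ) 1, x + t • (y - x) ∈ Metric.ball p r := fun t ht => by
    refine hcv.segment_subset hx.2 hy.2 ?_
    rw [segment_eq_image']
    exact ⟨t, ht, rfl⟩
  have hzpos : 0 < φ z := by
    by_contra! hzle
    rw [openSegment_eq_image'] at hz
    obtain ⟨t₁, ht₁, rfl⟩ := hz
    have hcont : ContinuousOn (fun t : ℝ => φ (x + t • (y - x))) (Icc 0 1) := by
      intro t ht
      have h1 : ContinuousAt φ (x + t • (y - x)) := (hball _ (hline t ht)).1.2.continuousAt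
      exact (ContinuousAt.comp (f := fun t : ℝ => x + t • (y - x)) h1
        (by fun_prop)).continuousWithinAt
    obtain ⟨t₀, ht₀, hmin⟩ := isCompact_Icc.exists_isMinOn ⟨0, by simp⟩ hcont
    -- If the minimum found is at an endpoint, its value is nonnegative, so `t₁`, where `φ ≤ 0`, is
    -- also a minimum. An interior minimum contradicts negativity of `D²φ` on the kernel of `Dφ`.
    obtain ⟨t₂, ht₂, hmin₂⟩ : ∃ t₂ ∈ Ioo (0 : ℝ) 1,
        IsMinOn (fun t : ℝ => φ (x + t • (y - x))) (Icc 0 1) t₂ := by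
      by_cases hmem : t₀ ∈ Ioo (0 : ℝ) 1
      · exact ⟨t₀, hmem, hmin⟩
      refine ⟨t₁, ht₁, fun t ht => ?_⟩
      have h0 : 0 ≤ φ (x + t₀ • (y - x)) := by
        have : t₀ = 0 ∨ t₀ = 1 := by
          by_contra! hne
          exact hmem ⟨lt_of_le_of_ne ht₀.1 hne.1.symm, lt_of_le_of_ne ht₀.2 hne.2⟩
        rcases this with rfl | rfl
        · simpa using hnonneg x hx
        · simpa using hnonneg y hy
      exact hzle.trans (h0.trans (hmin ht))
    obtain ⟨⟨-, hC⟩, hneg⟩ := hball _ (hline t₂ ⟨ht₂.1.le, ht₂.2.le⟩)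
    have hloc : IsLocalMax (fun s : ℝ => -1 * φ (x + t₂ • (y - x) + s • (y - x))) 0 := by
      have h1 : IsLocalMin (fun t : ℝ => φ (x + t • (y - x))) t₂ :=
        hmin₂.isLocalMin (Icc_mem_nhds ht₂.1 ht₂.2)
      have hc : Tendsto (fun s : ℝ => t₂ + s) (𝓝 0) (𝓝 t₂) := by
        have : Continuous (fun s : ℝ => t₂ + s) := by fun_prop
        simpa using this.tendsto 0
      filter_upwards [hc.eventually h1] with s hs
      have e : x + t₂ • (y - x) + s • (y - x) = x + (t₂ + s) • (y - x) := by module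
      rw [e]
      simp only [zero_smul, add_zero]
      linarith
    obtain ⟨e1, e2⟩ := ((HasTwoJet.const (-1)).mul
      (hC.hasTwoJet_line (y - x))).eq_zero_and_nonpos_of_isLocalMax hloc
    have := hneg (y - x) (sub_ne_zero.mpr hxy.symm) (by linarith)
    linarith
  have hzb : z ∈ Metric.ball p r :=
    hcv.segment_subset hx.2 hy.2 (openSegment_subset_segment ℝ x y hz)
  rw [mem_interior_iff_mem_nhds]
  filter_upwards [(hball z hzb).1.2.continuousAt.eventually_const_lt hzpos,
    Metric.isOpen_ball.mem_nhds hzb] with w hw hwb hwΩ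
  exact absurd (((hball w hwb).1.1).mp hwΩ) (not_lt.mpr hw.le)

end IsC2DefiningFunctionAt

/-! ### Components of the complement -/

/-- If the boundary curvature is positive, the components of the complement are strictly convex. -/
theorem strictConvex_connectedComponentIn_compl {Ω : Set Plane} (hΩ : IsOpen Ω)
    (hb : HasC2Boundary Ω) (hκ : HasPositiveBoundaryCurvature Ω) {x : Plane} (hx : x ∈ Ωᶜ) :
    StrictConvex ℝ (connectedComponentIn Ωᶜ x) := by
  set K := connectedComponentIn Ωᶜ x with hK
  have hKsub : K ⊆ Ωᶜ := connectedComponentIn_subset _ _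
  have hKconn : IsPreconnected K := isPreconnected_connectedComponentIn
  have hmax : ∀ S : Set Plane, IsPreconnected S → S ⊆ Ωᶜ → (S ∩ K).Nonempty → S ⊆ K := by
    rintro S hS hSΩ ⟨z, hzS, hzK⟩
    rw [hK, connectedComponentIn_eq hzK]
    exact hS.subset_connectedComponentIn hzS hSΩ
  have hKclosed : IsClosed K := by
    refine isClosed_of_closure_subset (hmax _ hKconn.closure
      (closure_minimal hKsub hΩ.isClosed_compl) ?_)
    exact ⟨x, subset_closure (mem_connectedComponentIn hx), mem_connectedComponentIn hx⟩
  have hint : ∀ z ∈ K, z ∈ interior Ωᶜ → z ∈ interior K := by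
    intro z hzK hz
    obtain ⟨r, hr, hsub⟩ := Metric.mem_nhds_iff.mp (mem_interior_iff_mem_nhds.mp hz)
    exact mem_interior_iff_mem_nhds.mpr (mem_of_superset (Metric.ball_mem_nhds z hr)
      (hmax _ (convex_ball z r).isPreconnected hsub ⟨z, Metric.mem_ball_self hr, hzK⟩))
  have hfront : ∀ z ∈ K, z ∉ interior Ωᶜ → ∃ r > 0, ∀ a ∈ Ωᶜ ∩ Metric.ball z r,
      ∀ b ∈ Ωᶜ ∩ Metric.ball z r, a ≠ b → openSegment ℝ a b ⊆ interior Ωᶜ := by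
    intro z hzK hz
    obtain ⟨φ, hφ⟩ := hb z ⟨by rwa [interior_compl, notMem_compl_iff] at hz,
      by rw [hΩ.interior_eq]; exact hKsub hzK⟩
    exact hφ.exists_ball_openSegment_subset hΩ hκ
  have hconvex : Convex ℝ K := by
    refine convex_of_isPreconnected_of_locally_convex hKclosed hKconn fun z hzK => ?_
    by_cases hz : z ∈ interior Ωᶜ
    · obtain ⟨r, hr, hsub⟩ := Metric.mem_nhds_iff.mp
        (mem_interior_iff_mem_nhds.mp (hint z hzK hz))
      exact ⟨r, hr, by rw [inter_eq_right.mpr hsub]; exact convex_ball z r⟩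
    obtain ⟨r, hr, hseg⟩ := hfront z hzK hz
    have hcv : Convex ℝ (Ωᶜ ∩ Metric.ball z r) := by
      rw [convex_iff_openSegment_subset]
      intro a ha b hb
      rcases eq_or_ne a b with rfl | hab
      · simpa using ha
      · exact subset_inter ((hseg a ha b hb hab).trans interior_subset)
          ((openSegment_subset_segment ℝ a b).trans
            ((convex_ball z r).segment_subset ha.2 hb.2))
    -- The local piece is convex, hence connected, so no other component of the complement enters
    -- this ball.
    have hsub : Ωᶜ ∩ Metric.ball z r ⊆ K := hmax _ hcv.isPreconnected inter_subset_left
      ⟨z, ⟨hKsub hzK, Metric.mem_ball_self hr⟩, hzK⟩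
    refine ⟨r, hr, ?_⟩
    rwa [show K ∩ Metric.ball z r = Ωᶜ ∩ Metric.ball z r from
      Subset.antisymm (inter_subset_inter_left _ hKsub) (subset_inter hsub inter_subset_right)]
  rw [strictConvex_iff_openSegment_subset]
  intro a ha b hb hab z hz
  have hzK : z ∈ K := hconvex.openSegment_subset ha hb hz
  refine hint z hzK ?_
  by_contra hznot
  obtain ⟨r, hr, hseg⟩ := hfront z hzK hznot
  rw [openSegment_eq_image'] at hz
  obtain ⟨t, ht, rfl⟩ := hz
  have hline : Tendsto (fun s : ℝ => a + s • (b - a)) (𝓝 t) (𝓝 (a + t • (b - a))) := by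
    have : Continuous (fun s : ℝ => a + s • (b - a)) := by fun_prop
    exact this.tendsto t
  obtain ⟨ε, hε, hsub⟩ := Metric.mem_nhds_iff.mp
    (inter_mem (hline (Metric.ball_mem_nhds _ hr)) (Icc_mem_nhds ht.1 ht.2))
  have hpt : ∀ s : ℝ, |s - t| < ε → a + s • (b - a) ∈ Ωᶜ ∩ Metric.ball (a + t • (b - a)) r := by
    intro s hs
    obtain ⟨h1, h2⟩ := hsub (by rwa [Metric.mem_ball, Real.dist_eq])
    refine ⟨hKsub (hconvex.segment_subset ha hb ?_), h1⟩
    rw [segment_eq_image']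
    exact ⟨s, h2, rfl⟩
  -- The point is the midpoint of a short subsegment inside the ball where local strict convexity
  -- holds.
  refine hznot (hseg _ (hpt (t - ε / 2) ?_) _ (hpt (t + ε / 2) ?_) ?_ ?_)
  · rw [abs_lt]; constructor <;> linarith
  · rw [abs_lt]; constructor <;> linarith
  · intro he
    have h1 : ε • (b - a) = 0 := by
      have := sub_eq_zero.mpr he.symm
      rw [← this]; module
    rcases smul_eq_zero.mp h1 with h2 | h2
    · exact hε.ne' h2
    · exact hab (sub_eq_zero.mp h2).symm
  · refine ⟨1 / 2, 1 / 2, by norm_num, by norm_num, by norm_num, ?_⟩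
    module

theorem corollary2p13
    (v₁ v₂ : Plane) (hv : LinearIndependent ℝ ![v₁, v₂])
    (D : Set Plane) (hD : IsOpen D) (hDper : IsDoublyPeriodicSet v₁ v₂ D)
    (x₀ : Plane) (hx₀ : x₀ ∈ D)
    (Ω : Set Plane) (hΩ : Ω = connectedComponentIn D x₀) (hΩ2 : HasC2Boundary Ω)
    (lam α : ℝ) (hlam : 0 < lam)
    (u : Plane → ℝ) (hu : IsOverdeterminedSolution Ω lam α u)
    (huper : IsDoublyPeriodicOn v₁ v₂ u Ω)
    (hmax : ∃ M : ℝ, M < |α| / Real.sqrt lam ∧ ∀ x ∈ Ω, u x ≤ M) :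
    (∀ x ∈ Ωᶜ, StrictConvex ℝ (connectedComponentIn Ωᶜ x)) ∧
      HasPositiveBoundaryCurvature Ω := by
  have hΩo : IsOpen Ω := hΩ ▸ hD.connectedComponentIn
  have hne : Ω.Nonempty := ⟨x₀, hΩ ▸ mem_connectedComponentIn hx₀⟩
  have hκ := hu.hasPositiveBoundaryCurvature hΩo hΩ2 hne hlam hmax
  exact ⟨fun x hx => strictConvex_connectedComponentIn_compl hΩo hΩ2 hκ hx, hκ⟩
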